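/- Let $X$ be a real Banach space, $T>0$, $h\in L^1(0,T;X)$, let $A\subset X\times X$ be an $m$-accretive (possibly multivalued) operator and let $u_0\in\overline{D(A)}$. Write $[u,v]:=\lim_{\lambda\downarrow 0}\frac{\|u+\lambda v\|-\|u\|}{\lambda}$. An integral solution of the problem $u'+Au\ni h$, $u(0)=u_0$, is a function $u\in C([0,T];X)$ with $u(0)=u_0$ and $$\|u(t)-\hat u\|-\|u(s)-\hat u\|\le\int_s^t[u(\tau)-\hat u,\,h(\tau)-\hat z]\,d\tau\qquad\text{for all }(\hat u,\hat z)\in A,\ 0\le s\le t\le T.$$ A mild solution is a function $u\in C([0,T];X)$ with $u(0)=u_0$ such that, for every $\varepsilon>0$, there are $0=t_0<t_1<\dots<t_N\le T$ with $t_i-t_{i-1}\le\varepsilon$ and $T-t_N\le\varepsilon$, and $g_1,\dots,g_N,\,v_0,\dots,v_N\in X$ with $\sum_i\int_{t_{i-1}}^{t_i}\|h(\tau)-g_i\|\,d\tau\le\varepsilon$, $\|v_0-u_0\|\le\varepsilon$, $\frac{v_i-v_{i-1}}{t_i-t_{i-1}}+Av_i\ni g_i$ for $1\le i\le N$, and $\|u(\tau)-v_i\|\le\varepsilon$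 for $\tau\in(t_{i-1},t_i]$, $1\le i\le N$. A measurable function $\nu:[0,T]\times[0,1]\to X$, $(t,\alpha)\mapsto\nu(t,\alpha)$, with $\nu(t,\cdot)\in L^1(0,1;X)$ for every $t\in(0,T]$, is an integral-process solution of this problem if $$\int_0^1\bigl(\|\nu(t,\alpha)-\hat u\|-\|\nu(s,\alpha)-\hat u\|\bigr)d\alpha\le\int_0^1\!\!\int_s^t[\nu(\tau,\alpha)-\hat u,\,h(\tau)-\hat z]\,d\tau\,d\alpha\qquad\text{for all }(\hat u,\hat z)\in A,\ 0<s\le t\le T,$$ and $\operatorname{ess-lim}_{t\downarrow0}\int_0^1\|\nu(t,\alpha)-u_0\|\,d\alpha=0$. Then the problem has a unique integral solution and a unique mild solution on $[0,T]$, and they are the same function $u$. A measurable function $\nu$ is an integral-process solution if and only if $\nu$ is independent of $\alpha$ and coincides with $u$, that is, for every $t\in(0,T]$ the function $\nu(t,\cdot)$ is almost everywhere constant on $[0,1]$, and $\nu(t,\alpha)=u(t)$ for almost every $\alpha\in[0,1]$. In that case, for almost every $\alpha$, $\nu(\cdot,\alpha)=u$ almost everywhere on $(0,T)$. -/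

import Mathlib

open Set Filter Topology MeasureTheory

/-- The bracket `[u, v] = lim_{l ↓ 0} (‖u + l v‖ - ‖u‖) / l` of a real normed space. The limit
always exists, see `tendsto_normBracket`. -/
noncomputable def normBracket {X : Type*} [NormedAddCommGroup X] [NormedSpace ℝ X]
    (u v : X) : ℝ :=
  limUnder (𝓝[>] (0 : ℝ)) (fun l : ℝ => (‖u + l • v‖ - ‖u‖) / l)

/-- The limit that defines the bracket exists. -/
theorem tendsto_normBracket {X : Type*} [NormedAddCommGroup X] [NormedSpace ℝ X] (u v : X) :
    Tendsto (fun l : ℝ => (‖u + l • v‖ - ‖u‖) / l) (𝓝[>] (0 : ℝ)) (𝓝 (normBracket u v)) := by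
  have hmono : MonotoneOn (fun l : ℝ => (‖u + l • v‖ - ‖u‖) / l) (Ioi 0) := by
    intro a ha b hb hab
    have ha' : (0 : ℝ) < a := ha
    have hb' : (0 : ℝ) < b := hb
    have key : b * ‖u + a • v‖ ≤ a * ‖u + b • v‖ + (b - a) * ‖u‖ := by
      have e : b • (u + a • v) = a • (u + b • v) + (b - a) • u := by
        module
      have h1 := norm_add_le (a • (u + b • v)) ((b - a) • u)
      rw [← e, norm_smul, norm_smul, norm_smul, Real.norm_of_nonneg ha'.le,
        Real.norm_of_nonneg hb'.le, Real.norm_of_nonneg (sub_nonneg.2 hab)] at h1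
      exact h1
    change (‖u + a • v‖ - ‖u‖) / a ≤ (‖u + b • v‖ - ‖u‖) / b
    rw [div_le_div_iff₀ ha' hb']
    nlinarith
  have hbdd : BddBelow ((fun l : ℝ => (‖u + l • v‖ - ‖u‖) / l) '' Ioi 0) := by
    refine ⟨-‖v‖, ?_⟩
    rintro _ ⟨l, hl, rfl⟩
    have hl' : (0 : ℝ) < l := hl
    change -‖v‖ ≤ (‖u + l • v‖ - ‖u‖) / l
    rw [le_div_iff₀ hl']
    have h1 := norm_sub_le (u + l • v) (l • v)
    rw [add_sub_cancel_right, norm_smul, Real.norm_of_nonneg hl'.le] at h1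
    nlinarith
  exact tendsto_nhds_limUnder ⟨_, hmono.tendsto_nhdsGT hbdd⟩

/-- A (possibly multivalued, nonlinear) operator `A ⊆ X × X` is accretive if its resolvents are
nonexpansive. -/
def IsAccretive {X : Type*} [NormedAddCommGroup X] [NormedSpace ℝ X] (A : Set (X × X)) : Prop :=
  ∀ p ∈ A, ∀ q ∈ A, ∀ l : ℝ, 0 < l → ‖p.1 - q.1‖ ≤ ‖(p.1 - q.1) + l • (p.2 - q.2)‖

/-- `A` is m-accretive if it is accretive and the range of `I + l A` is `X` for all `l > 0`. -/
def IsMAccretive {X : Type*} [NormedAddCommGroup X] [NormedSpace ℝ X] (A : Set (X × X)) : Prop :=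
  IsAccretive A ∧ ∀ l : ℝ, 0 < l → ∀ g : X, ∃ p ∈ A, p.1 + l • p.2 = g

/-- The domain `D(A)` of an operator `A ⊆ X × X`. -/
def operatorDomain {X : Type*} (A : Set (X × X)) : Set X := Prod.fst '' A

/-- Integral solutions on `[0, T]` of `u' + A u ∋ h`, `u(0) = u₀`. -/
structure IsIntegralSolution {X : Type*} [NormedAddCommGroup X] [NormedSpace ℝ X]
    (A : Set (X × X)) (T : ℝ) (h : ℝ → X) (u₀ : X) (u : ℝ → X) : Prop where
  continuousOn : ContinuousOn u (Icc 0 T)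
  initial : u 0 = u₀
  ineq : ∀ p ∈ A, ∀ s t : ℝ, 0 ≤ s → s ≤ t → t ≤ T →
    ‖u t - p.1‖ - ‖u s - p.1‖ ≤ ∫ τ in s..t, normBracket (u τ - p.1) (h τ - p.2)

/-- The data `0 = t 0 < t 1 < ⋯ < t N`, `g 0, …, g (N - 1)`, `v 0, …, v N` form an
`ε`-approximate solution of `u' + A u ∋ h`, `u(0) = u₀` on `[0, T]` by the implicit Euler scheme
`(v (i + 1) - v i) / (t (i + 1) - t i) + A (v (i + 1)) ∋ g i`. -/
structure IsApproxSolution {X : Type*} [NormedAddCommGroup X] [NormedSpace ℝ X]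
    (A : Set (X × X)) (T : ℝ) (h : ℝ → X) (u₀ : X) (ε : ℝ)
    (N : ℕ) (t : ℕ → ℝ) (g v : ℕ → X) : Prop where
  start : t 0 = 0
  lt_succ : ∀ i < N, t i < t (i + 1)
  step_le : ∀ i < N, t (i + 1) - t i ≤ ε
  last_le : t N ≤ T
  le_last : T - t N ≤ ε
  source : ∑ i ∈ Finset.range N, ∫ τ in (t i)..(t (i + 1)), ‖h τ - g i‖ ≤ ε
  initial : ‖v 0 - u₀‖ ≤ ε
  scheme : ∀ i < N, (v (i + 1), g i - (t (i + 1) - t i)⁻¹ • (v (i + 1) - v i)) ∈ A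

/-- Mild solutions on `[0, T]` of `u' + A u ∋ h`, `u(0) = u₀`: continuous functions that are
uniform limits of the piecewise constant `ε`-approximate solutions as `ε → 0`. -/
structure IsMildSolution {X : Type*} [NormedAddCommGroup X] [NormedSpace ℝ X]
    (A : Set (X × X)) (T : ℝ) (h : ℝ → X) (u₀ : X) (u : ℝ → X) : Prop where
  continuousOn : ContinuousOn u (Icc 0 T)
  initial : u 0 = u₀
  approx : ∀ ε : ℝ, 0 < ε → ∃ (N : ℕ) (t : ℕ → ℝ) (g v : ℕ → X),
    IsApproxSolution A T h u₀ ε N t g v ∧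
      ∀ i < N, ∀ τ ∈ Ioc (t i) (t (i + 1)), ‖u τ - v (i + 1)‖ ≤ ε

/-- `ν : (t, α) ↦ ν t α` is (strongly, almost everywhere) measurable on `(0, T] × [0, 1]`. -/
def IsProcessMeasurable {X : Type*} [NormedAddCommGroup X] (T : ℝ) (ν : ℝ → ℝ → X) : Prop :=
  AEStronglyMeasurable (Function.uncurry ν) (volume.restrict (Ioc (0 : ℝ) T ×ˢ Icc (0 : ℝ) 1))

/-- Integral-process solutions on `[0, T]` of `u' + A u ∋ h` with datum `u₀`. The first two
fields say that the integrals in the others are meaningful. The filter `𝓝[>] 0 ⊓ ae volume`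
expresses the essential limit as `t ↓ 0`. -/
structure IsIntegralProcessSolution {X : Type*} [NormedAddCommGroup X] [NormedSpace ℝ X]
    (A : Set (X × X)) (T : ℝ) (h : ℝ → X) (u₀ : X) (ν : ℝ → ℝ → X) : Prop where
  measurable : IsProcessMeasurable T ν
  integrable : ∀ t ∈ Ioc (0 : ℝ) T, IntegrableOn (ν t) (Icc (0 : ℝ) 1)
  ineq : ∀ p ∈ A, ∀ s t : ℝ, 0 < s → s ≤ t → t ≤ T →
    ∫ α in Icc (0 : ℝ) 1, (‖ν t α - p.1‖ - ‖ν s α - p.1‖) ≤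
      ∫ α in Icc (0 : ℝ) 1, ∫ τ in s..t, normBracket (ν τ α - p.1) (h τ - p.2)
  initial : Tendsto (fun t : ℝ => ∫ α in Icc (0 : ℝ) 1, ‖ν t α - u₀‖)
    (𝓝[>] (0 : ℝ) ⊓ ae (volume : Measure ℝ)) (𝓝 0)

/-- `ν` does not depend on `α`: at each time `t ∈ (0, T]`, the function `ν t` is constant, up to
a null set of values of `α`. -/
def IsIndependentOfParameter {X : Type*} (T : ℝ) (ν : ℝ → ℝ → X) : Prop :=
  ∀ t ∈ Ioc (0 : ℝ) T, ∃ x : X, ∀ᵐ α ∂(volume.restrict (Icc (0 : ℝ) 1)), ν t α = x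

/-! Everything is compared with implicit Euler schemes. Let `v` be such a scheme with step δ. The
pairs `(v (i + 1), g i - δ⁻¹ • (v (i + 1) - v i))` lie in `A`, so an integral-process solution ν may
be tested with them. Bounding the bracket by the difference quotient with increment δ gives, for the
mean distances D_i(τ) = ∫₀¹ ‖ν(τ,α) - v i‖ dα, the integrated form of δ D_{i+1}' ≤ δ ‖h - g i‖ + D_i
- D_{i+1} (`mul_processDist_sub_le`). This is Kobayashi's recursion for two schemes with one
discrete time made continuous, and a barrier of the same kind controls it
(`processDist_le_of_isApproxSolution`). Since schemes approximate the mild solution u, the mean of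
‖ν(t,·) - u(t)‖ vanishes at every t. This yields independence of α and the identity with u at once.
An integral solution is a process constant in α, so the same estimate gives uniqueness of integral
solutions.

Existence rests on Kobayashi's estimate for two schemes (`IsApproxSolution.norm_sub_le`), a double
induction driven by `IsAccretive.two_step` and `sqrt_two_step`. With completeness it makes the
schemes, which m-accretivity supplies, converge uniformly to a mild solution. Mild solutions are
integral solutions: a discrete inequality is summed along the scheme, then the mesh and afterwards
the increment `l` tend to zero. The source is only integrable, so it is replaced throughout by a
continuous `k` with an almost Lipschitz modulus. -/

section Source

/-! ### Continuous approximation of the source. -/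

variable {X : Type*} [NormedAddCommGroup X]

/-- `k` is a bounded continuous function that is `η`-close to `h` in `L¹(0, T)` and whose
oscillation is at most affine, up to the error `η`. -/
structure IsSourceApprox (T η B L : ℝ) (h k : ℝ → X) : Prop where
  continuous : Continuous k
  norm_le : ∀ t, ‖k t‖ ≤ B
  nonneg : 0 ≤ L
  modulus : ∀ s t, ‖k s - k t‖ ≤ η + L * |s - t|
  error : ∫ τ in (0 : ℝ)..T, ‖h τ - k τ‖ ≤ η

theorem exists_isSourceApprox [NormedSpace ℝ X] {T : ℝ} (hT : 0 < T) {h : ℝ → X} (hh : IntegrableOn h (Ioc 0 T))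
    {η : ℝ} (hη : 0 < η) : ∃ (B L : ℝ) (k : ℝ → X), IsSourceApprox T η B L h k := by
  have hi : Integrable h (volume.restrict (Ioc 0 T)) := hh
  have hreg : (volume.restrict (Ioc (0 : ℝ) T)).Regular :=
    Measure.Regular.restrict_of_measure_ne_top (by simp)
  obtain ⟨k, hkc, hke, hkcont, -⟩ := hi.exists_hasCompactSupport_integral_sub_le hη
  obtain ⟨B, hB⟩ := hkc.exists_bound_of_continuous hkcont
  obtain ⟨d, hd, hkd⟩ := Metric.uniformContinuous_iff.1
    (hkc.uniformContinuous_of_continuous hkcont) η hη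
  have hB0 : 0 ≤ B := (norm_nonneg _).trans (hB 0)
  -- Within distance `d`, uniform continuity gives `η`; beyond it, the trivial bound `2 * B` is at
  -- most `2 * B / d * |s - t|`.
  refine ⟨B, 2 * B / d, k, hkcont, hB, by positivity, fun s t => ?_, ?_⟩
  · rcases lt_or_ge (dist s t) d with hst | hst
    · have h1 := (hkd hst).le
      rw [dist_eq_norm] at h1
      have h2 : 0 ≤ 2 * B / d * |s - t| := by positivity
      linarith
    · rw [Real.dist_eq] at hst
      have h1 : ‖k s - k t‖ ≤ 2 * B := by
        linarith [norm_sub_le (k s) (k t), hB s, hB t]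
      have h2 : 2 * B ≤ 2 * B / d * |s - t| := by
        rw [div_mul_eq_mul_div, le_div_iff₀ hd]
        exact mul_le_mul_of_nonneg_left hst (by positivity)
      linarith
  · rwa [intervalIntegral.integral_of_le hT.le]

theorem intervalIntegrable_of_mem {T : ℝ} {E : Type*} [NormedAddCommGroup E] {h : ℝ → E}
    (hh : IntegrableOn h (Ioc 0 T)) {a b : ℝ} (ha : 0 ≤ a) (hab : a ≤ b) (hb : b ≤ T) :
    IntervalIntegrable h volume a b :=
  (intervalIntegrable_iff_integrableOn_Ioc_of_le hab).2 (hh.mono_set (Ioc_subset_Ioc ha hb))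

namespace IsSourceApprox

variable {T η B L : ℝ} {h k : ℝ → X}

/-- Replaces the constant source of a scheme by the value of `k` at the right node, which makes the
sources of different schemes comparable. -/
theorem integral_const_le (hk : IsSourceApprox T η B L h k) (hh : IntegrableOn h (Ioc 0 T))
    {a b ε : ℝ} (ha : 0 ≤ a) (hab : a ≤ b) (hb : b ≤ T) (hε : b - a ≤ ε) (g : X) :
    (b - a) * ‖g - k b‖ ≤ (∫ τ in a..b, ‖h τ - g‖) + (∫ τ in a..b, ‖h τ - k τ‖) +
      (b - a) * (η + L * ε) := by
  have hi := intervalIntegrable_of_mem hh ha hab hb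
  have i1 : IntervalIntegrable (fun τ => ‖h τ - g‖) volume a b :=
    (hi.sub intervalIntegrable_const).norm
  have i2 : IntervalIntegrable (fun τ => ‖h τ - k τ‖) volume a b :=
    (hi.sub (hk.continuous.intervalIntegrable _ _)).norm
  have i3 : IntervalIntegrable (fun _ : ℝ => η + L * ε) volume a b := intervalIntegrable_const
  have key : ∫ _ in a..b, ‖g - k b‖ ≤ ∫ τ in a..b, (‖h τ - g‖ + ‖h τ - k τ‖ + (η + L * ε)) := by
    refine intervalIntegral.integral_mono_on hab intervalIntegrable_const ((i1.add i2).add i3) ?_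
    intro τ hτ
    have h1 : ‖g - k b‖ ≤ ‖h τ - g‖ + ‖h τ - k τ‖ + ‖k τ - k b‖ := by
      have e : g - k b = -(h τ - g) + (h τ - k τ) + (k τ - k b) := by abel
      rw [e]
      refine (norm_add₃_le).trans ?_
      rw [norm_neg]
    have h2 := hk.modulus τ b
    have h3 : |τ - b| ≤ ε := by
      rw [abs_sub_comm, abs_of_nonneg (by linarith [hτ.2])]
      linarith [hτ.1]
    linarith [mul_le_mul_of_nonneg_left h3 hk.nonneg]
  rw [intervalIntegral.integral_add (i1.add i2) i3, intervalIntegral.integral_add i1 i2] at key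
  simpa only [intervalIntegral.integral_const, smul_eq_mul] using key

/-- On a short interval, `h` is close in `L¹` to the constant value of `k` at the right end. -/
theorem integral_norm_sub_le (hk : IsSourceApprox T η B L h k) (hh : IntegrableOn h (Ioc 0 T))
    {a b ε : ℝ} (ha : 0 ≤ a) (hab : a ≤ b) (hb : b ≤ T) (hε : b - a ≤ ε) :
    ∫ τ in a..b, ‖h τ - k b‖ ≤ (∫ τ in a..b, ‖h τ - k τ‖) + (b - a) * (η + L * ε) := by
  have hi := intervalIntegrable_of_mem hh ha hab hb
  have i1 : IntervalIntegrable (fun τ => ‖h τ - k b‖) volume a b :=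
    (hi.sub intervalIntegrable_const).norm
  have i2 : IntervalIntegrable (fun τ => ‖h τ - k τ‖) volume a b :=
    (hi.sub (hk.continuous.intervalIntegrable _ _)).norm
  have i3 : IntervalIntegrable (fun _ : ℝ => η + L * ε) volume a b := intervalIntegrable_const
  have key : ∫ τ in a..b, ‖h τ - k b‖ ≤ ∫ τ in a..b, (‖h τ - k τ‖ + (η + L * ε)) := by
    refine intervalIntegral.integral_mono_on hab i1 (i2.add i3) ?_
    intro τ hτ
    have h1 : ‖h τ - k b‖ ≤ ‖h τ - k τ‖ + ‖k τ - k b‖ := norm_sub_le_norm_sub_add_norm_sub _ _ _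
    have h2 := hk.modulus τ b
    have h3 : |τ - b| ≤ ε := by
      rw [abs_sub_comm, abs_of_nonneg (by linarith [hτ.2])]
      linarith [hτ.1]
    linarith [mul_le_mul_of_nonneg_left h3 hk.nonneg]
  rw [intervalIntegral.integral_add i2 i3] at key
  simpa only [intervalIntegral.integral_const, smul_eq_mul] using key

end IsSourceApprox

end Source

/-! ### Accretivity in the form of Euler steps. -/

section Accretive

variable {X : Type*} [NormedAddCommGroup X] [NormedSpace ℝ X]

/-- Accretivity with parameter δγ/(δ+γ): after multiplication by δ+γ, the right-hand side splits
into an Euler step of length δ ending at `p` and one of length γ ending at `q`. -/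
theorem IsAccretive.two_step {A : Set (X × X)} (hA : IsAccretive A) {p q : X × X} (hp : p ∈ A)
    (hq : q ∈ A) {δ γ : ℝ} (hδ : 0 < δ) (hγ : 0 < γ) :
    (δ + γ) * ‖p.1 - q.1‖ ≤
      ‖γ • (p.1 + δ • p.2 - q.1) + δ • (p.1 - (q.1 + γ • q.2))‖ := by
  have hs : 0 < δ + γ := by positivity
  have h1 := mul_le_mul_of_nonneg_left (hA p hp q hq (δ * γ / (δ + γ)) (by positivity)) hs.le
  refine h1.trans (le_of_eq ?_)
  rw [← Real.norm_of_nonneg hs.le, ← norm_smul, Real.norm_of_nonneg hs.le, smul_add, smul_smul,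
    mul_div_cancel₀ _ hs.ne']
  congr 1
  module

theorem IsAccretive.one_step {A : Set (X × X)} (hA : IsAccretive A) {p q : X × X} (hp : p ∈ A)
    (hq : q ∈ A) {δ : ℝ} (hδ : 0 < δ) :
    ‖p.1 - q.1‖ ≤ ‖p.1 + δ • p.2 - q.1‖ + δ * ‖q.2‖ := by
  refine (hA p hp q hq δ hδ).trans ?_
  have e : (p.1 - q.1) + δ • (p.2 - q.2) = (p.1 + δ • p.2 - q.1) - δ • q.2 := by module
  rw [e]
  refine (norm_sub_le _ _).trans ?_
  rw [norm_smul, Real.norm_of_nonneg hδ.le]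

end Accretive

/-- The accumulated deviation of the sources `g` of an Euler scheme from `k`. -/
def sourceDeviation {X : Type*} [NormedAddCommGroup X] (k : ℝ → X) (t : ℕ → ℝ) (g : ℕ → X)
    (i : ℕ) : ℝ :=
  ∑ l ∈ Finset.range i, (t (l + 1) - t l) * ‖g l - k (t (l + 1))‖

/-! ### Elementary properties of Euler schemes. -/

namespace IsApproxSolution

variable {X : Type*} [NormedAddCommGroup X] [NormedSpace ℝ X] {A : Set (X × X)} {T : ℝ}
  {h : ℝ → X} {u₀ : X} {ε : ℝ} {N : ℕ} {t : ℕ → ℝ} {g v : ℕ → X}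

theorem mono_eps (H : IsApproxSolution A T h u₀ ε N t g v) {ε' : ℝ} (hε : ε ≤ ε') :
    IsApproxSolution A T h u₀ ε' N t g v :=
  ⟨H.start, H.lt_succ, fun i hi => (H.step_le i hi).trans hε, H.last_le, H.le_last.trans hε,
    H.source.trans hε, H.initial.trans hε, H.scheme⟩

theorem mono (H : IsApproxSolution A T h u₀ ε N t g v) {i j : ℕ} (hij : i ≤ j) (hj : j ≤ N) :
    t i ≤ t j := by
  induction j, hij using Nat.le_induction with
  | base => exact le_rfl
  | succ j _ ih => exact (ih (by omega)).trans (H.lt_succ j (by omega)).le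

theorem nonneg (H : IsApproxSolution A T h u₀ ε N t g v) {i : ℕ} (hi : i ≤ N) : 0 ≤ t i :=
  H.start ▸ H.mono (Nat.zero_le i) hi

theorem le_T (H : IsApproxSolution A T h u₀ ε N t g v) {i : ℕ} (hi : i ≤ N) : t i ≤ T :=
  (H.mono hi le_rfl).trans H.last_le

theorem eps_nonneg (H : IsApproxSolution A T h u₀ ε N t g v) : 0 ≤ ε :=
  (norm_nonneg _).trans H.initial

/-- Every time is close to a node with positive index. -/
theorem exists_node (H : IsApproxSolution A T h u₀ ε N t g v) (hε : ε < T) {r : ℝ} (hr0 : 0 ≤ r)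
    (hr : r ≤ T) : ∃ i < N, |t (i + 1) - r| ≤ ε := by
  -- The index must be positive because a mild solution is compared with its scheme only on `Ioc (t
  -- i) (t (i + 1))`, where `v 0` plays no role. The bound `ε < T` excludes a scheme without steps.
  have hN : N ≠ 0 := by
    rintro rfl
    linarith [H.le_last, H.start]
  rcases le_or_gt r (t N) with hrN | hrN
  · have hex : ∃ i, r ≤ t (i + 1) := ⟨N - 1, by rwa [Nat.sub_add_cancel (by omega)]⟩
    classical
    have hmin : Nat.find hex ≤ N - 1 :=
      Nat.find_min' hex (by rwa [Nat.sub_add_cancel (by omega)])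
    have hlt : Nat.find hex < N := by omega
    refine ⟨Nat.find hex, hlt, ?_⟩
    have h1 := Nat.find_spec hex
    have h2 := H.step_le _ hlt
    have h3 : t (Nat.find hex) ≤ r := by
      rcases Nat.eq_zero_or_pos (Nat.find hex) with h0 | h0
      · rw [h0, H.start]; exact hr0
      · have := Nat.find_min hex (m := Nat.find hex - 1) (by omega)
        rw [Nat.sub_add_cancel h0] at this
        exact (not_le.1 this).le
    rw [abs_of_nonneg (by linarith)]
    linarith
  · refine ⟨N - 1, by omega, ?_⟩
    rw [Nat.sub_add_cancel (by omega), abs_of_nonpos (by linarith)]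
    linarith [H.le_last]

theorem sourceDeviation_le {η B L : ℝ} {k : ℝ → X} (H : IsApproxSolution A T h u₀ ε N t g v)
    (hk : IsSourceApprox T η B L h k) (hη : 0 ≤ η) (hh : IntegrableOn h (Ioc 0 T)) {i : ℕ}
    (hi : i ≤ N) : sourceDeviation k t g i ≤ ε + η + T * (η + L * ε) := by
  have hε := H.eps_nonneg
  have hLε : 0 ≤ η + L * ε := add_nonneg hη (mul_nonneg hk.nonneg hε)
  have hterm : ∀ l ∈ Finset.range i, (t (l + 1) - t l) * ‖g l - k (t (l + 1))‖ ≤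
      (∫ τ in (t l)..(t (l + 1)), ‖h τ - g l‖) + (∫ τ in (t l)..(t (l + 1)), ‖h τ - k τ‖) +
        (t (l + 1) - t l) * (η + L * ε) := by
    intro l hl
    have hl' : l < N := (Finset.mem_range.1 hl).trans_le hi
    exact hk.integral_const_le hh (H.nonneg hl'.le) (H.lt_succ l hl').le (H.le_T hl')
      (H.step_le l hl') _
  refine (Finset.sum_le_sum hterm).trans ?_
  rw [Finset.sum_add_distrib, Finset.sum_add_distrib, ← Finset.sum_mul, Finset.sum_range_sub,
    intervalIntegral.sum_integral_adjacent_intervals, H.start, sub_zero]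
  · have h1 : ∑ l ∈ Finset.range i, ∫ τ in (t l)..(t (l + 1)), ‖h τ - g l‖ ≤ ε := by
      refine (Finset.sum_le_sum_of_subset_of_nonneg (Finset.range_subset_range.2 hi) ?_).trans H.source
      intro l hl _
      exact intervalIntegral.integral_nonneg (H.lt_succ l (Finset.mem_range.1 hl)).le
        fun _ _ => norm_nonneg _
    have hT0 : 0 ≤ T := (H.nonneg le_rfl).trans H.last_le
    have h2 : ∫ τ in (0 : ℝ)..(t i), ‖h τ - k τ‖ ≤ η := by
      refine le_trans ?_ hk.error
      refine intervalIntegral.integral_mono_interval le_rfl (H.nonneg hi) (H.le_T hi)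
        (Eventually.of_forall fun _ => norm_nonneg _) ?_
      exact ((intervalIntegrable_of_mem hh le_rfl hT0 le_rfl).sub
        (hk.continuous.intervalIntegrable _ _)).norm
    have h3 : t i * (η + L * ε) ≤ T * (η + L * ε) :=
      mul_le_mul_of_nonneg_right (H.le_T hi) hLε
    linarith
  · intro l hl
    have hl' : l < N := hl.trans_le hi
    exact ((intervalIntegrable_of_mem hh (H.nonneg hl'.le) (H.lt_succ l hl').le (H.le_T hl')).sub
      (hk.continuous.intervalIntegrable _ _)).norm

theorem scheme_add (H : IsApproxSolution A T h u₀ ε N t g v) {i : ℕ} (hi : i < N) :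
    v (i + 1) + (t (i + 1) - t i) • (g i - (t (i + 1) - t i)⁻¹ • (v (i + 1) - v i)) =
      v i + (t (i + 1) - t i) • g i := by
  have hδ : t (i + 1) - t i ≠ 0 := (sub_pos.2 (H.lt_succ i hi)).ne'
  rw [smul_sub, smul_smul, mul_inv_cancel₀ hδ]
  module

/-- Supplies the boundary of the index grid in the double induction. The element `p` stands in for
the datum, which need not lie in the domain. -/
theorem norm_sub_le_of_mem {η B L : ℝ} {k : ℝ → X} (H : IsApproxSolution A T h u₀ ε N t g v)
    (hA : IsAccretive A) (hk : IsSourceApprox T η B L h k) {p : X × X} (hp : p ∈ A) {i : ℕ}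
    (hi : i ≤ N) :
    ‖v i - p.1‖ ≤ ‖v 0 - p.1‖ + sourceDeviation k t g i + (B + ‖p.2‖) * t i := by
  induction i with
  | zero => simp [sourceDeviation, H.start]
  | succ i ih =>
    have hi' : i < N := hi
    have ih := ih hi'.le
    have hδ : 0 < t (i + 1) - t i := sub_pos.2 (H.lt_succ i hi')
    have h1 := hA.one_step (H.scheme i hi') hp hδ
    simp only at h1
    rw [H.scheme_add hi'] at h1
    have h2 : ‖v i + (t (i + 1) - t i) • g i - p.1‖ ≤
        ‖v i - p.1‖ + (t (i + 1) - t i) * ‖g i‖ := by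
      have e : v i + (t (i + 1) - t i) • g i - p.1 = (v i - p.1) + (t (i + 1) - t i) • g i := by
        abel
      rw [e]
      refine (norm_add_le _ _).trans ?_
      rw [norm_smul, Real.norm_of_nonneg hδ.le]
    have h3 : ‖g i‖ ≤ ‖g i - k (t (i + 1))‖ + B := by
      have := norm_add_le (g i - k (t (i + 1))) (k (t (i + 1)))
      rw [sub_add_cancel] at this
      linarith [hk.norm_le (t (i + 1))]
    have h4 := mul_le_mul_of_nonneg_left h3 hδ.le
    have e : sourceDeviation k t g (i + 1) = sourceDeviation k t g i +
      (t (i + 1) - t i) * ‖g i - k (t (i + 1))‖ := Finset.sum_range_succ _ _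
    rw [e]
    linarith

end IsApproxSolution

/-! ### Kobayashi's estimate for two Euler schemes. -/

section Kobayashi

/-- Write a, b, c for the three roots in order. By convexity of the square it suffices that γa² +
δb² ≤ (δ+γ)c², and the difference of the two sides is exactly γδ((ε-δ) + (ε-γ)). The term linear in
ε under the root thus pays for the squared steps. -/
theorem sqrt_two_step {t s δ γ ε : ℝ} (hδ : 0 < δ) (hγ : 0 < γ) (hδε : δ ≤ ε) (hγε : γ ≤ ε)
    (ht : δ ≤ t) (hs : γ ≤ s) :
    γ * √((t - δ - s) ^ 2 + ε * (t - δ + s)) + δ * √((t - (s - γ)) ^ 2 + ε * (t + (s - γ))) ≤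
      (δ + γ) * √((t - s) ^ 2 + ε * (t + s)) := by
  have hε : 0 < ε := hδ.trans_le hδε
  have hP : 0 ≤ (t - δ - s) ^ 2 + ε * (t - δ + s) := by
    have : 0 ≤ t - δ + s := by linarith
    positivity
  have hQ : 0 ≤ (t - (s - γ)) ^ 2 + ε * (t + (s - γ)) := by
    have : 0 ≤ t + (s - γ) := by linarith
    positivity
  have hR : 0 ≤ (t - s) ^ 2 + ε * (t + s) := by
    have : 0 ≤ t + s := by linarith
    positivity
  have sP := Real.sq_sqrt hP
  have sQ := Real.sq_sqrt hQ
  have sR := Real.sq_sqrt hR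
  set a := √((t - δ - s) ^ 2 + ε * (t - δ + s))
  set b := √((t - (s - γ)) ^ 2 + ε * (t + (s - γ)))
  set c := √((t - s) ^ 2 + ε * (t + s))
  have hc : 0 ≤ c := Real.sqrt_nonneg _
  refine abs_le_of_sq_le_sq' ?_ (by positivity) |>.2
  have h1 : (γ * a + δ * b) ^ 2 ≤ (δ + γ) * (γ * a ^ 2 + δ * b ^ 2) := by
    have : 0 ≤ δ * γ * (a - b) ^ 2 := by positivity
    linarith
  have h2 : γ * a ^ 2 + δ * b ^ 2 ≤ (δ + γ) * c ^ 2 := by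
    rw [sP, sQ, sR]
    have : 0 ≤ γ * δ * ((ε - δ) + (ε - γ)) :=
      mul_nonneg (by positivity) (by linarith)
    linarith
  calc (γ * a + δ * b) ^ 2 ≤ (δ + γ) * (γ * a ^ 2 + δ * b ^ 2) := h1
    _ ≤ (δ + γ) * ((δ + γ) * c ^ 2) := mul_le_mul_of_nonneg_left h2 (by positivity)
    _ = ((δ + γ) * c) ^ 2 := by ring

theorem abs_le_sqrt_add {a b : ℝ} (hb : 0 ≤ b) : |a| ≤ √(a ^ 2 + b) :=
  Real.abs_le_sqrt (by linarith)

variable {X : Type*} [NormedAddCommGroup X] [NormedSpace ℝ X] {A : Set (X × X)} {T : ℝ}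
  {h : ℝ → X} {u₀ : X} {ε : ℝ} {N : ℕ} {t : ℕ → ℝ} {g v : ℕ → X}

/-- The Euler step for the distance of two schemes. -/
theorem IsApproxSolution.norm_sub_step (H : IsApproxSolution A T h u₀ ε N t g v)
    (hA : IsAccretive A) {ε' : ℝ} {N' : ℕ} {s : ℕ → ℝ} {f w : ℕ → X}
    (H' : IsApproxSolution A T h u₀ ε' N' s f w) {i j : ℕ} (hi : i < N) (hj : j < N') :
    ((t (i + 1) - t i) + (s (j + 1) - s j)) * ‖v (i + 1) - w (j + 1)‖ ≤
      (s (j + 1) - s j) * ‖v i - w (j + 1)‖ + (t (i + 1) - t i) * ‖v (i + 1) - w j‖ +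
        (t (i + 1) - t i) * (s (j + 1) - s j) * ‖g i - f j‖ := by
  have hδ : 0 < t (i + 1) - t i := sub_pos.2 (H.lt_succ i hi)
  have hγ : 0 < s (j + 1) - s j := sub_pos.2 (H'.lt_succ j hj)
  refine (hA.two_step (H.scheme i hi) (H'.scheme j hj) hδ hγ).trans ?_
  simp only
  rw [H.scheme_add hi, H'.scheme_add hj]
  set δ := t (i + 1) - t i
  set γ := s (j + 1) - s j
  have e : γ • (v i + δ • g i - w (j + 1)) + δ • (v (i + 1) - (w j + γ • f j)) =
      γ • (v i - w (j + 1)) + δ • (v (i + 1) - w j) + (δ * γ) • (g i - f j) := by module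
  rw [e]
  refine (norm_add₃_le).trans ?_
  rw [norm_smul, norm_smul, norm_smul, Real.norm_of_nonneg hδ.le, Real.norm_of_nonneg hγ.le,
    Real.norm_of_nonneg (mul_nonneg hδ.le hγ.le)]

/-- Kobayashi's estimate for the distance of two Euler schemes. -/
theorem IsApproxSolution.norm_sub_le {η B L : ℝ} {k : ℝ → X}
    (H : IsApproxSolution A T h u₀ ε N t g v)
    (hA : IsAccretive A) {N' : ℕ} {s : ℕ → ℝ} {f w : ℕ → X}
    (H' : IsApproxSolution A T h u₀ ε N' s f w) (hk : IsSourceApprox T η B L h k) (hη : 0 ≤ η)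
    {p : X × X} (hp : p ∈ A) {i j : ℕ} (hi : i ≤ N) (hj : j ≤ N') :
    ‖v i - w j‖ ≤ ‖v 0 - p.1‖ + ‖w 0 - p.1‖ + sourceDeviation k t g i + sourceDeviation k s f j +
      (B + ‖p.2‖) * √((t i - s j) ^ 2 + ε * (t i + s j)) +
      t i * (η + L * (√((t i - s j) ^ 2 + ε * (t i + s j)) + ε)) := by
  have hε := H.eps_nonneg
  have hL := hk.nonneg
  have hM : 0 ≤ B + ‖p.2‖ := add_nonneg ((norm_nonneg _).trans (hk.norm_le 0)) (norm_nonneg _)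
  induction i generalizing j with
  | zero =>
    have h1 := H'.norm_sub_le_of_mem hA hk hp hj
    have h2 : ‖v 0 - w j‖ ≤ ‖v 0 - p.1‖ + ‖w j - p.1‖ := by
      rw [norm_sub_rev (w j)]; exact norm_sub_le_norm_sub_add_norm_sub _ _ _
    have h3 : s j ≤ √((t 0 - s j) ^ 2 + ε * (t 0 + s j)) := by
      refine (le_abs_self _).trans ?_
      rw [← abs_neg, H.start]
      have := H'.nonneg hj
      simpa using abs_le_sqrt_add (a := s j) (b := ε * s j) (by positivity)
    have h4 : sourceDeviation k t g 0 = 0 := by simp [sourceDeviation]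
    rw [h4, H.start]
    rw [H.start] at h3
    linarith [mul_le_mul_of_nonneg_left h3 hM]
  | succ i ih =>
    have hi' : i < N := hi
    induction j with
    | zero =>
      have h1 := H.norm_sub_le_of_mem hA hk hp hi
      have h2 : ‖v (i + 1) - w 0‖ ≤ ‖v (i + 1) - p.1‖ + ‖w 0 - p.1‖ := by
        rw [norm_sub_rev (w 0)]; exact norm_sub_le_norm_sub_add_norm_sub _ _ _
      have ht := H.nonneg hi
      have h3 : t (i + 1) ≤ √((t (i + 1) - s 0) ^ 2 + ε * (t (i + 1) + s 0)) := by
        refine (le_abs_self _).trans ?_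
        rw [H'.start]
        simpa using abs_le_sqrt_add (a := t (i + 1)) (b := ε * t (i + 1)) (by positivity)
      have h4 : sourceDeviation k s f 0 = 0 := by simp [sourceDeviation]
      rw [h4]
      set ψ := √((t (i + 1) - s 0) ^ 2 + ε * (t (i + 1) + s 0))
      have hψ : 0 ≤ ψ := ht.trans h3
      have h5 : 0 ≤ t (i + 1) * (η + L * (ψ + ε)) := by positivity
      linarith [mul_le_mul_of_nonneg_left h3 hM]
    | succ j ihj =>
      have hj' : j < N' := hj
      have a1 := ih hi'.le hj
      have a2 := ihj hj'.le
      have h1 := H.norm_sub_step hA H' hi' hj'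
      have hδ : 0 < t (i + 1) - t i := sub_pos.2 (H.lt_succ i hi')
      have hγ : 0 < s (j + 1) - s j := sub_pos.2 (H'.lt_succ j hj')
      have hδε := H.step_le i hi'
      have hγε := H'.step_le j hj'
      have ht0 := H.nonneg hi'.le
      have hs0 := H'.nonneg hj'.le
      have e1 : sourceDeviation k t g (i + 1) = sourceDeviation k t g i +
        (t (i + 1) - t i) * ‖g i - k (t (i + 1))‖ := Finset.sum_range_succ _ _
      have e2 : sourceDeviation k s f (j + 1) = sourceDeviation k s f j +
        (s (j + 1) - s j) * ‖f j - k (s (j + 1))‖ := Finset.sum_range_succ _ _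
      have hψ := sqrt_two_step (t := t (i + 1)) (s := s (j + 1)) hδ hγ hδε hγε
        (by linarith) (by linarith)
      rw [sub_sub_cancel, sub_sub_cancel] at hψ
      have hsrc : ‖g i - f j‖ ≤ ‖g i - k (t (i + 1))‖ + ‖f j - k (s (j + 1))‖ +
          (η + L * |t (i + 1) - s (j + 1)|) := by
        have e : g i - f j = (g i - k (t (i + 1))) - (f j - k (s (j + 1))) +
          (k (t (i + 1)) - k (s (j + 1))) := by abel
        rw [e]
        refine (norm_add_le _ _).trans ?_
        exact add_le_add (_root_.norm_sub_le _ _) (hk.modulus _ _)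
      -- The root at `(i, j + 1)` is used, at the price of `ε`, so that the source term can merge
      -- with the inductive bound there.
      have habs : |t (i + 1) - s (j + 1)| ≤
          √((t i - s (j + 1)) ^ 2 + ε * (t i + s (j + 1))) + ε := by
        have h2 : |t i - s (j + 1)| ≤ √((t i - s (j + 1)) ^ 2 + ε * (t i + s (j + 1))) :=
          abs_le_sqrt_add (mul_nonneg hε (by linarith))
        have h3 : |t (i + 1) - s (j + 1)| ≤ |t (i + 1) - t i| + |t i - s (j + 1)| :=
          abs_sub_le _ _ _
        rw [abs_of_pos hδ] at h3
        linarith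
      rw [e1] at a2 ⊢
      rw [e2] at a1 ⊢
      set ψ := √((t (i + 1) - s (j + 1)) ^ 2 + ε * (t (i + 1) + s (j + 1)))
      set ψ₁ := √((t i - s (j + 1)) ^ 2 + ε * (t i + s (j + 1)))
      set ψ₂ := √((t (i + 1) - s j) ^ 2 + ε * (t (i + 1) + s j))
      have ht1 : 0 ≤ t (i + 1) := by linarith
      have hsrc' : ‖g i - f j‖ ≤ ‖g i - k (t (i + 1))‖ + ‖f j - k (s (j + 1))‖ +
          (η + L * (ψ₁ + ε)) := by
        linarith [mul_le_mul_of_nonneg_left habs hL]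
      have m1 := mul_le_mul_of_nonneg_left a1 hγ.le
      have m2 := mul_le_mul_of_nonneg_left a2 hδ.le
      have m3 := mul_le_mul_of_nonneg_left hsrc' (mul_nonneg hδ.le hγ.le)
      -- The source term raises the factor `t i` of the bound at `(i, j + 1)` to `t (i + 1)`. Both
      -- roots then carry the weight `B + ‖p.2‖ + L * t (i + 1)`, and `hψ` applies.
      have m4 := mul_le_mul_of_nonneg_left hψ
        (add_nonneg hM (mul_nonneg hL ht1))
      refine le_of_mul_le_mul_left ?_ (add_pos hδ hγ)
      refine h1.trans ?_
      linarith

/-- The bound that Kobayashi's estimates give for `ε`-approximate solutions. -/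
noncomputable def kobayashiBound (T η M L ε : ℝ) : ℝ :=
  2 * (ε + η) + 2 * (ε + η + T * (η + L * ε)) + η + M * √(ε ^ 2 + ε * (2 * T)) +
    T * (η + L * (√(ε ^ 2 + ε * (2 * T)) + ε))

/-- At ε = 0 the bound equals (5 + 3T)η, and it is continuous in ε. The order of choices matters:
`k` and `p`, hence `L` and `M`, depend on η, so ε comes last. -/
theorem exists_kobayashiBound_lt {T η κ : ℝ} (M L : ℝ) (hη : (5 + 3 * T) * η < κ) :
    ∃ ε > 0, kobayashiBound T η M L ε < κ := by
  have hc : Continuous (kobayashiBound T η M L) := by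
    unfold kobayashiBound
    fun_prop
  have h0 : kobayashiBound T η M L 0 < κ := by
    simp only [kobayashiBound]
    norm_num
    linarith
  have h1 : ∀ᶠ ε in 𝓝[>] (0 : ℝ), kobayashiBound T η M L ε < κ :=
    ((hc.tendsto 0).eventually_lt_const h0).filter_mono nhdsWithin_le_nhds
  obtain ⟨ε, h2, h3⟩ := (h1.and self_mem_nhdsWithin).exists
  exact ⟨ε, h3, h2⟩

theorem exists_mem_norm_sub_le {X : Type*} [NormedAddCommGroup X] {A : Set (X × X)} {u₀ : X}
    (hu₀ : u₀ ∈ closure (operatorDomain A)) {η : ℝ} (hη : 0 < η) :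
    ∃ p ∈ A, ‖u₀ - p.1‖ ≤ η := by
  obtain ⟨x, ⟨p, hp, rfl⟩, hx⟩ := Metric.mem_closure_iff.1 hu₀ η hη
  exact ⟨p, hp, by rw [← dist_eq_norm]; exact hx.le⟩

/-- Approximate solutions with the same datum are close to each other. -/
theorem exists_forall_norm_sub_le (hA : IsAccretive A) (hT : 0 < T)
    (hh : IntegrableOn h (Ioc 0 T)) (hu₀ : u₀ ∈ closure (operatorDomain A)) {κ : ℝ}
    (hκ : 0 < κ) : ∃ ε > 0, ∀ (N : ℕ) (t : ℕ → ℝ) (g v : ℕ → X) (N' : ℕ) (s : ℕ → ℝ)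
      (f w : ℕ → X), IsApproxSolution A T h u₀ ε N t g v → IsApproxSolution A T h u₀ ε N' s f w →
      ∀ i ≤ N, ∀ j ≤ N', |t i - s j| ≤ ε → ‖v i - w j‖ ≤ κ := by
  set η := κ / (2 * (5 + 3 * T)) with hηdef
  have hη : 0 < η := by positivity
  have hηκ : (5 + 3 * T) * η < κ := by
    rw [hηdef]
    have : (5 + 3 * T) * (κ / (2 * (5 + 3 * T))) = κ / 2 := by field_simp
    linarith
  obtain ⟨B, L, k, hk⟩ := exists_isSourceApprox hT hh hη
  obtain ⟨p, hp, hpη⟩ := exists_mem_norm_sub_le hu₀ hη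
  obtain ⟨ε, hε, hεκ⟩ := exists_kobayashiBound_lt (B + ‖p.2‖) L hηκ
  refine ⟨ε, hε, fun N t g v N' s f w H H' i hi j hj hij => ?_⟩
  refine le_trans ?_ hεκ.le
  have hL := hk.nonneg
  have hM : 0 ≤ B + ‖p.2‖ := add_nonneg ((norm_nonneg _).trans (hk.norm_le 0)) (norm_nonneg _)
  have h1 := H.norm_sub_le hA H' hk hη.le hp hi hj
  have h2 := H.sourceDeviation_le hk hη.le hh hi
  have h3 := H'.sourceDeviation_le hk hη.le hh hj
  have h4 : ‖v 0 - p.1‖ ≤ ε + η :=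
    (norm_sub_le_norm_sub_add_norm_sub _ u₀ _).trans (add_le_add H.initial hpη)
  have h5 : ‖w 0 - p.1‖ ≤ ε + η :=
    (norm_sub_le_norm_sub_add_norm_sub _ u₀ _).trans (add_le_add H'.initial hpη)
  have h6 : √((t i - s j) ^ 2 + ε * (t i + s j)) ≤ √(ε ^ 2 + ε * (2 * T)) := by
    refine Real.sqrt_le_sqrt (add_le_add ?_ ?_)
    · rw [← sq_abs]
      exact pow_le_pow_left₀ (abs_nonneg _) hij 2
    · exact mul_le_mul_of_nonneg_left (by linarith [H.le_T hi, H'.le_T hj]) hε.le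
  have h7 := mul_le_mul_of_nonneg_left h6 hM
  have h8 : t i * (η + L * (√((t i - s j) ^ 2 + ε * (t i + s j)) + ε)) ≤
      T * (η + L * (√(ε ^ 2 + ε * (2 * T)) + ε)) := by
    have := H.le_T hi
    gcongr
  unfold kobayashiBound
  linarith

end Kobayashi

/-! ### Construction of Euler schemes from resolvents. -/

section Existence

variable {X : Type*} [NormedAddCommGroup X] [NormedSpace ℝ X]

/-- Approximate solutions exist. -/
theorem IsMAccretive.exists_isApproxSolution {A : Set (X × X)} (hA : IsMAccretive A) {T : ℝ}
    (hT : 0 < T) {h : ℝ → X} (hh : IntegrableOn h (Ioc 0 T)) (u₀ : X) {ε : ℝ} (hε : 0 < ε) :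
    ∃ (N : ℕ) (t : ℕ → ℝ) (g v : ℕ → X), IsApproxSolution A T h u₀ ε N t g v := by
  set η := ε / (2 + 2 * T) with hηdef
  have hη : 0 < η := by positivity
  obtain ⟨B, L, k, hk⟩ := exists_isSourceApprox hT hh hη
  have hL := hk.nonneg
  -- The step δ = T/n then satisfies δ ≤ ε and Lδ ≤ η, so the total source error is at most η + 2Tη
  -- ≤ ε.
  obtain ⟨n, hn⟩ := exists_nat_gt (max (T / ε) (T * L / η))
  have hn0 : (0 : ℝ) < n := lt_of_le_of_lt (le_max_of_le_left (by positivity)) hn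
  have hn1 : T / n ≤ ε := by
    rw [div_le_comm₀ hn0 hε]; exact (le_max_left _ _).trans hn.le
  have hn2 : L * (T / n) ≤ η := by
    have : T * L / η ≤ n := (le_max_right _ _).trans hn.le
    rw [div_le_comm₀ hη hn0] at this
    calc L * (T / n) = T * L / n := by ring
      _ ≤ η := this
  set δ := T / n with hδdef
  have hδ : 0 < δ := by positivity
  choose R hRA hR using fun z => hA.2 δ hδ z
  set t : ℕ → ℝ := fun i => i * δ with ht
  set g : ℕ → X := fun i => k (t (i + 1)) with hg
  set v : ℕ → X := fun i => Nat.rec u₀ (fun i z => (R (z + δ • g i)).1) i with hv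
  have hstep : ∀ i, t (i + 1) - t i = δ := by
    intro i; simp only [ht]; push_cast; ring
  have htn : t n = T := by simp only [ht, hδdef]; field_simp
  have hmono : ∀ i j, i ≤ j → t i ≤ t j := by
    intro i j hij
    simp only [ht]
    gcongr
  have ht0 : t 0 = 0 := by simp [ht]
  refine ⟨n, t, g, v, ht0, fun i _ => by linarith [hstep i],
    fun i _ => by rw [hstep]; exact hn1, htn.le, by rw [htn]; linarith, ?_, ?_, ?_⟩
  · have hterm : ∀ i ∈ Finset.range n, ∫ τ in (t i)..(t (i + 1)), ‖h τ - g i‖ ≤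
        (∫ τ in (t i)..(t (i + 1)), ‖h τ - k τ‖) + (t (i + 1) - t i) * (η + L * δ) := by
      intro i hi
      refine hk.integral_norm_sub_le hh (ht0 ▸ hmono 0 i (Nat.zero_le _)) (hmono _ _ (by omega)) ?_
        (hstep i).le
      exact htn ▸ hmono _ _ (Finset.mem_range.1 hi)
    refine (Finset.sum_le_sum hterm).trans ?_
    rw [Finset.sum_add_distrib, ← Finset.sum_mul, Finset.sum_range_sub,
      intervalIntegral.sum_integral_adjacent_intervals, ht0, htn, sub_zero]
    · have h1 := hk.error
      have h2 : T * (η + L * δ) ≤ T * (2 * η) :=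
        mul_le_mul_of_nonneg_left (by linarith) hT.le
      have h3 : η + T * (2 * η) ≤ (2 + 2 * T) * η := by linarith
      have h4 : (2 + 2 * T) * η = ε := by rw [hηdef]; field_simp
      linarith
    · intro i hi
      exact ((intervalIntegrable_of_mem hh (ht0 ▸ hmono 0 i (Nat.zero_le _))
        (hmono _ _ (by omega)) (htn ▸ hmono _ _ hi)).sub
        (hk.continuous.intervalIntegrable _ _)).norm
  · simpa [hv] using hε.le
  · intro i _
    rw [hstep]
    have hv1 : v (i + 1) = (R (v i + δ • g i)).1 := rfl
    have h1 := hR (v i + δ • g i)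
    have h2 : g i - δ⁻¹ • (v (i + 1) - v i) = (R (v i + δ • g i)).2 := by
      have h3 : v (i + 1) - v i = δ • g i - δ • (R (v i + δ • g i)).2 := by
        rw [hv1, sub_eq_sub_iff_add_eq_add, h1]
        abel
      rw [h3, ← smul_sub, smul_smul, inv_mul_cancel₀ hδ.ne', one_smul, sub_sub_cancel]
    rw [h2, hv1]
    exact hRA _

end Existence

/-! ### Bounds and measurability for the bracket. -/

section Bracket

variable {X : Type*} [NormedAddCommGroup X] [NormedSpace ℝ X]

theorem abs_norm_add_smul_sub_norm_div_le (u v : X) {l : ℝ} (hl : 0 < l) :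
    |(‖u + l • v‖ - ‖u‖) / l| ≤ ‖v‖ := by
  rw [abs_div, abs_of_pos hl, div_le_iff₀ hl]
  refine (abs_norm_sub_norm_le _ _).trans ?_
  rw [add_sub_cancel_left, norm_smul, Real.norm_of_nonneg hl.le, mul_comm]

theorem abs_normBracket_le (u v : X) : |normBracket u v| ≤ ‖v‖ :=
  le_of_tendsto (tendsto_normBracket u v).abs <| eventually_nhdsWithin_of_forall
    fun _ hl => abs_norm_add_smul_sub_norm_div_le u v hl

/-- By convexity of the norm the quotient is nondecreasing in `l`. A finite increment equal to the
step is what turns the bracket into an Euler step. -/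
theorem normBracket_le_div (u v : X) {l : ℝ} (hl : 0 < l) :
    normBracket u v ≤ (‖u + l • v‖ - ‖u‖) / l := by
  refine le_of_tendsto (tendsto_normBracket u v) ?_
  filter_upwards [Ioo_mem_nhdsGT hl] with a ha
  rw [div_le_div_iff₀ ha.1 hl]
  have e : l • (u + a • v) = a • (u + l • v) + (l - a) • u := by module
  have h1 := norm_add_le (a • (u + l • v)) ((l - a) • u)
  rw [← e, norm_smul, norm_smul, norm_smul, Real.norm_of_nonneg ha.1.le,
    Real.norm_of_nonneg hl.le, Real.norm_of_nonneg (sub_nonneg.2 ha.2.le)] at h1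
  linarith

theorem aestronglyMeasurable_normBracket {Ω : Type*} [MeasurableSpace Ω] {μ : Measure Ω}
    {f g : Ω → X} (hf : AEStronglyMeasurable f μ) (hg : AEStronglyMeasurable g μ) :
    AEStronglyMeasurable (fun ω => normBracket (f ω) (g ω)) μ := by
  refine aestronglyMeasurable_of_tendsto_ae (𝓝[>] (0 : ℝ))
    (f := fun l ω => (‖f ω + l • g ω‖ - ‖f ω‖) / l) (fun l => ?_)
    (Eventually.of_forall fun ω => tendsto_normBracket _ _)
  exact (((hf.add (hg.const_smul l)).norm.sub hf.norm).mul_const l⁻¹)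

end Bracket

/-! ### Convergence of the schemes to a mild solution. -/

section MildExistence

variable {X : Type*} [NormedAddCommGroup X] [NormedSpace ℝ X] [CompleteSpace X]
  {A : Set (X × X)} {T : ℝ} {h : ℝ → X} {u₀ : X}

/-- The approximate solutions converge uniformly. -/
theorem IsMAccretive.exists_limit (hA : IsMAccretive A) (hT : 0 < T)
    (hh : IntegrableOn h (Ioc 0 T)) (hu₀ : u₀ ∈ closure (operatorDomain A)) :
    ∃ u : ℝ → X, ∀ κ > 0, ∃ ε > 0, ∀ (N : ℕ) (t : ℕ → ℝ) (g v : ℕ → X),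
      IsApproxSolution A T h u₀ ε N t g v → ∀ i ≤ N, ∀ τ ∈ Icc 0 T, |t i - τ| ≤ ε →
        ‖u τ - v i‖ ≤ κ := by
  -- The summand 2 keeps the mesh below `T` even for n = 0, as `exists_node` requires.
  have hpos : ∀ n : ℕ, 0 < T / (n + 2 : ℝ) := fun n => by positivity
  choose N t g v H using fun n : ℕ => hA.exists_isApproxSolution hT hh u₀ (hpos n)
  have hlt : ∀ n : ℕ, T / (n + 2 : ℝ) < T := fun n => by
    rw [div_lt_iff₀ (by positivity)]
    nlinarith [(n.cast_nonneg : (0 : ℝ) ≤ n)]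
  have hnode : ∀ (n : ℕ) (τ : ℝ), ∃ i ≤ N n, τ ∈ Icc 0 T → |t n i - τ| ≤ T / (n + 2 : ℝ) := by
    intro n τ
    by_cases hτ : τ ∈ Icc 0 T
    · obtain ⟨i, hi, h1⟩ := (H n).exists_node (hlt n) hτ.1 hτ.2
      exact ⟨i + 1, hi, fun _ => h1⟩
    · exact ⟨0, Nat.zero_le _, fun h => absurd h hτ⟩
  choose idx hidx hnear using hnode
  have hlim : Tendsto (fun n : ℕ => T / (n + 2 : ℝ)) atTop (𝓝 0) :=
    tendsto_const_nhds.div_atTop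
      (tendsto_atTop_add_const_right _ _ tendsto_natCast_atTop_atTop)
  -- Closeness to the tail of the sequence serves twice: applied to a member of the sequence it
  -- gives the Cauchy property, and in the limit it gives the claim.
  have hclose : ∀ κ > 0, ∃ ε > 0, (∀ (N' : ℕ) (s : ℕ → ℝ) (f w : ℕ → X),
      IsApproxSolution A T h u₀ ε N' s f w → ∀ i ≤ N', ∀ τ ∈ Icc 0 T, |s i - τ| ≤ ε →
        ∀ᶠ n in atTop, ‖v n (idx n τ) - w i‖ ≤ κ) := by
    intro κ hκ
    obtain ⟨ε, hε, hK⟩ := exists_forall_norm_sub_le hA.1 hT hh hu₀ hκ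
    refine ⟨ε / 2, half_pos hε, fun N' s f w H' i hi τ hτ hiτ => ?_⟩
    filter_upwards [hlim.eventually_le_const (half_pos hε)] with n hn
    refine hK _ _ _ _ _ _ _ _ ((H n).mono_eps (by linarith)) (H'.mono_eps (by linarith))
      _ (hidx n τ) _ hi ?_
    have h1 := hnear n τ hτ
    have h2 := abs_sub_le (t n (idx n τ)) τ (s i)
    rw [abs_sub_comm τ] at h2
    linarith
  have hcauchy : ∀ τ ∈ Icc 0 T, CauchySeq fun n => v n (idx n τ) := by
    intro τ hτ
    refine Metric.cauchySeq_iff'.2 fun κ hκ => ?_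
    obtain ⟨ε, hε, hK⟩ := hclose (κ / 4) (by positivity)
    obtain ⟨m, hm⟩ := (hlim.eventually_le_const hε).exists
    have h1 := hK _ _ _ _ ((H m).mono_eps hm) (idx m τ) (hidx m τ) τ hτ
      ((hnear m τ hτ).trans hm)
    obtain ⟨n₀, hn₀⟩ := eventually_atTop.1 h1
    refine ⟨n₀, fun n hn => ?_⟩
    have h2 := hn₀ n hn
    have h3 := hn₀ n₀ le_rfl
    rw [dist_eq_norm]
    have h4 := norm_sub_le_norm_sub_add_norm_sub (v n (idx n τ)) (v m (idx m τ)) (v n₀ (idx n₀ τ))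
    rw [norm_sub_rev (v m _)] at h4
    linarith
  refine ⟨fun τ => limUnder atTop fun n => v n (idx n τ), fun κ hκ => ?_⟩
  obtain ⟨ε, hε, hK⟩ := hclose κ hκ
  refine ⟨ε, hε, fun N' s f w H' i hi τ hτ hiτ => ?_⟩
  exact le_of_tendsto ((hcauchy τ hτ).tendsto_limUnder.sub_const (w i)).norm
    (hK N' s f w H' i hi τ hτ hiτ)

/-- Mild solutions exist. -/
theorem IsMAccretive.exists_isMildSolution (hA : IsMAccretive A) (hT : 0 < T)
    (hh : IntegrableOn h (Ioc 0 T)) (hu₀ : u₀ ∈ closure (operatorDomain A)) :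
    ∃ u : ℝ → X, IsMildSolution A T h u₀ u := by
  obtain ⟨u, hu⟩ := hA.exists_limit hT hh hu₀
  refine ⟨u, ?_, ?_, ?_⟩
  · refine Metric.continuousOn_iff.2 fun τ hτ κ hκ => ?_
    obtain ⟨ε, hε, hK⟩ := hu (κ / 4) (by positivity)
    refine ⟨ε / 2, half_pos hε, fun σ hσ hστ => ?_⟩
    -- A single value of one scheme is close to `u` at both nearby times.
    obtain ⟨N, t, g, v, H⟩ := hA.exists_isApproxSolution hT hh u₀
      (lt_min (half_pos hε) (half_pos hT))
    obtain ⟨i, hi, h1⟩ := H.exists_node ((min_le_right _ _).trans_lt (half_lt_self hT)) hτ.1 hτ.2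
    have h1' := h1.trans (min_le_left _ _)
    have H' := H.mono_eps (ε' := ε) ((min_le_left _ _).trans (by linarith))
    have h2 := hK _ _ _ _ H' (i + 1) hi τ hτ (by linarith)
    have h3 := hK _ _ _ _ H' (i + 1) hi σ hσ (by
      have h4 := abs_sub_le (t (i + 1)) τ σ
      rw [Real.dist_eq, abs_sub_comm] at hστ
      linarith)
    rw [dist_eq_norm]
    have h5 := norm_sub_le_norm_sub_add_norm_sub (u σ) (v (i + 1)) (u τ)
    rw [norm_sub_rev (v (i + 1))] at h5
    linarith
  · refine eq_of_forall_dist_le fun κ hκ => ?_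
    obtain ⟨ε, hε, hK⟩ := hu (κ / 2) (by positivity)
    obtain ⟨N, t, g, v, H⟩ := hA.exists_isApproxSolution hT hh u₀ (lt_min hε (half_pos hκ))
    have h1 := hK _ _ _ _ (H.mono_eps (min_le_left _ _)) 0 (Nat.zero_le _) 0 ⟨le_rfl, hT.le⟩
      (by simp [H.start, hε.le])
    have h2 := H.initial.trans (min_le_right _ _)
    rw [dist_eq_norm]
    have h3 := norm_sub_le_norm_sub_add_norm_sub (u 0) (v 0) u₀
    linarith
  · intro ε hε
    obtain ⟨ε₁, hε₁, hK⟩ := hu ε hε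
    obtain ⟨N, t, g, v, H⟩ := hA.exists_isApproxSolution hT hh u₀ (lt_min hε hε₁)
    refine ⟨N, t, g, v, H.mono_eps (min_le_left _ _), fun i hi τ hτ => ?_⟩
    refine hK _ _ _ _ (H.mono_eps (min_le_right _ _)) (i + 1) hi τ
      ⟨(H.nonneg hi.le).trans hτ.1.le, hτ.2.trans (H.le_T hi)⟩ ?_
    rw [abs_of_nonneg (by linarith [hτ.2])]
    have := (H.step_le i hi).trans (min_le_right _ _)
    linarith [hτ.1]

end MildExistence

/-! ### Mild solutions are integral solutions. -/

section MildIntegral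

variable {X : Type*} [NormedAddCommGroup X] [NormedSpace ℝ X] {A : Set (X × X)} {T : ℝ}
  {h : ℝ → X} {u₀ : X}

/-- The two-step inequality with the fixed pair `p` in place of a second scheme and a fictitious
step `l`. The increment stays positive until the mesh has vanished, since the difference quotient,
unlike the bracket in general, is Lipschitz in both arguments. -/
theorem IsApproxSolution.mul_norm_sub_le {ε : ℝ} {N : ℕ} {t : ℕ → ℝ} {g v : ℕ → X}
    (H : IsApproxSolution A T h u₀ ε N t g v) (hA : IsAccretive A) {p : X × X} (hp : p ∈ A)
    {l : ℝ} (hl : 0 < l) {i : ℕ} (hi : i < N) :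
    l * (‖v (i + 1) - p.1‖ - ‖v i - p.1‖) ≤ (t (i + 1) - t i) *
      (‖v (i + 1) - p.1 + l • (g i - p.2)‖ - ‖v (i + 1) - p.1‖) := by
  have hδ : 0 < t (i + 1) - t i := sub_pos.2 (H.lt_succ i hi)
  have h1 := hA.two_step (H.scheme i hi) hp hδ hl
  simp only at h1
  rw [H.scheme_add hi] at h1
  set δ := t (i + 1) - t i
  have e : l • (v i + δ • g i - p.1) + δ • (v (i + 1) - (p.1 + l • p.2)) =
      l • (v i - p.1) + δ • (v (i + 1) - p.1 + l • (g i - p.2)) := by module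
  have h2 := norm_add_le (l • (v i - p.1)) (δ • (v (i + 1) - p.1 + l • (g i - p.2)))
  rw [norm_smul, norm_smul, Real.norm_of_nonneg hl.le, Real.norm_of_nonneg hδ.le] at h2
  rw [e] at h1
  linarith

theorem ContinuousOn.aestronglyMeasurable_Ioc {X : Type*} [NormedAddCommGroup X] {T : ℝ} {u : ℝ → X} (hu : ContinuousOn u (Icc 0 T)) :
    AEStronglyMeasurable u (volume.restrict (Ioc 0 T)) :=
  (hu.aestronglyMeasurable measurableSet_Icc).mono_measure
    (Measure.restrict_mono Ioc_subset_Icc_self le_rfl)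

theorem integrableOn_norm_add_smul_div {u : ℝ → X} (hu : ContinuousOn u (Icc 0 T))
    (hh : IntegrableOn h (Ioc 0 T)) (p : X × X) {l : ℝ} (hl : 0 < l) :
    IntegrableOn (fun τ => (‖u τ - p.1 + l • (h τ - p.2)‖ - ‖u τ - p.1‖) / l) (Ioc 0 T) := by
  have hu' := hu.aestronglyMeasurable_Ioc
  have hh' : Integrable (fun τ => h τ - p.2) (volume.restrict (Ioc 0 T)) :=
    hh.sub (integrable_const _)
  have hup : AEStronglyMeasurable (fun τ => u τ - p.1) (volume.restrict (Ioc 0 T)) :=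
    hu'.sub aestronglyMeasurable_const
  refine Integrable.mono' hh'.norm ?_ (Eventually.of_forall fun τ => ?_)
  · exact ((hup.add (hh'.1.const_smul l)).norm.sub hup.norm).mul_const l⁻¹
  · exact abs_norm_add_smul_sub_norm_div_le _ _ hl

theorem IsApproxSolution.norm_sub_norm_le_integral {ε : ℝ} {N : ℕ} {t : ℕ → ℝ} {g v : ℕ → X}
    (H : IsApproxSolution A T h u₀ ε N t g v) (hA : IsAccretive A)
    (hh : IntegrableOn h (Ioc 0 T)) {u : ℝ → X} (hu : ContinuousOn u (Icc 0 T))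
    (huv : ∀ i < N, ∀ τ ∈ Ioc (t i) (t (i + 1)), ‖u τ - v (i + 1)‖ ≤ ε)
    {p : X × X} (hp : p ∈ A) {l : ℝ} (hl : 0 < l) {i j : ℕ} (hij : i ≤ j) (hj : j ≤ N) :
    ‖v j - p.1‖ - ‖v i - p.1‖ ≤
      (∫ τ in (t i)..(t j), (‖u τ - p.1 + l • (h τ - p.2)‖ - ‖u τ - p.1‖) / l) +
        (t j - t i) * (2 * ε / l) +
        ∑ m ∈ Finset.Ico i j, ∫ τ in (t m)..(t (m + 1)), ‖h τ - g m‖ := by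
  have hq := integrableOn_norm_add_smul_div hu hh p hl
  induction j, hij using Nat.le_induction with
  | base => simp
  | succ j hij ih =>
    have hjN : j < N := hj
    have ih := ih hjN.le
    have hδ : 0 < t (j + 1) - t j := sub_pos.2 (H.lt_succ j hjN)
    have h1 := H.mul_norm_sub_le hA hp hl hjN
    rw [Finset.sum_Ico_succ_top hij]
    have hti := H.nonneg (hij.trans hjN.le)
    have i0 := intervalIntegrable_of_mem hq hti (H.mono hij hjN.le) (H.le_T hjN.le)
    have i1 := intervalIntegrable_of_mem hq (H.nonneg hjN.le) (H.lt_succ j hjN).le (H.le_T hjN)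
    have i2 : IntervalIntegrable (fun τ => ‖h τ - g j‖) volume (t j) (t (j + 1)) :=
      ((intervalIntegrable_of_mem hh (H.nonneg hjN.le) (H.lt_succ j hjN).le (H.le_T hjN)).sub
        intervalIntegrable_const).norm
    have i3 : IntervalIntegrable (fun _ : ℝ => 2 * ε / l) volume (t j) (t (j + 1)) :=
      intervalIntegrable_const
    rw [← intervalIntegral.integral_add_adjacent_intervals i0 i1]
    have key : (∫ _ in (t j)..(t (j + 1)),
        (‖v (j + 1) - p.1 + l • (g j - p.2)‖ - ‖v (j + 1) - p.1‖) / l) ≤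
        ∫ τ in (t j)..(t (j + 1)), ((‖u τ - p.1 + l • (h τ - p.2)‖ - ‖u τ - p.1‖) / l +
          2 * ε / l + ‖h τ - g j‖) := by
      refine intervalIntegral.integral_mono_on_of_le_Ioo (H.lt_succ j hjN).le
        intervalIntegrable_const ((i1.add i3).add i2) fun τ hτ => ?_
      have h2 := huv j hjN τ ⟨hτ.1, hτ.2.le⟩
      have h3 : ‖v (j + 1) - p.1 + l • (g j - p.2)‖ ≤ ‖u τ - p.1 + l • (h τ - p.2)‖ +
          ‖u τ - v (j + 1)‖ + l * ‖h τ - g j‖ := by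
        have e : v (j + 1) - p.1 + l • (g j - p.2) = (u τ - p.1 + l • (h τ - p.2)) -
            (u τ - v (j + 1)) - l • (h τ - g j) := by module
        rw [e]
        refine (_root_.norm_sub_le _ _).trans ?_
        rw [norm_smul, Real.norm_of_nonneg hl.le]
        exact add_le_add_left (_root_.norm_sub_le _ _) _
      have h4 : ‖u τ - p.1‖ ≤ ‖u τ - v (j + 1)‖ + ‖v (j + 1) - p.1‖ :=
        norm_sub_le_norm_sub_add_norm_sub _ _ _
      rw [← add_div, div_add' _ _ _ hl.ne']
      refine div_le_div_of_nonneg_right ?_ hl.le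
      linarith
    rw [intervalIntegral.integral_add (i1.add i3) i2, intervalIntegral.integral_add i1 i3,
      intervalIntegral.integral_const, intervalIntegral.integral_const, smul_eq_mul,
      smul_eq_mul] at key
    have h5 : ‖v (j + 1) - p.1‖ - ‖v j - p.1‖ ≤ (t (j + 1) - t j) *
        ((‖v (j + 1) - p.1 + l • (g j - p.2)‖ - ‖v (j + 1) - p.1‖) / l) := by
      rw [← mul_div_assoc, le_div_iff₀ hl]
      linarith
    linarith

theorem IsMildSolution.norm_sub_norm_le_integral {u : ℝ → X} (hu : IsMildSolution A T h u₀ u)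
    (hA : IsAccretive A) (hT : 0 < T) (hh : IntegrableOn h (Ioc 0 T)) {p : X × X} (hp : p ∈ A)
    {l : ℝ} (hl : 0 < l) {s t : ℝ} (hs : 0 ≤ s) (hst : s < t) (ht : t ≤ T) :
    ‖u t - p.1‖ - ‖u s - p.1‖ ≤
      ∫ τ in s..t, (‖u τ - p.1 + l • (h τ - p.2)‖ - ‖u τ - p.1‖) / l := by
  set q : ℝ → ℝ := fun τ => (‖u τ - p.1 + l • (h τ - p.2)‖ - ‖u τ - p.1‖) / l with hqdef
  have hq : IntegrableOn q (Ioc 0 T) := integrableOn_norm_add_smul_div hu.continuousOn hh p hl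
  have hsI : s ∈ Icc 0 T := ⟨hs, by linarith⟩
  have htI : t ∈ Icc 0 T := ⟨by linarith, ht⟩
  have hF : ContinuousOn (fun r => ∫ τ in (0 : ℝ)..r, q τ) (Icc 0 T) := by
    have := intervalIntegral.continuousOn_primitive_interval (a := 0) (b := T) (f := q)
      (μ := volume) (by rw [uIcc_of_le hT.le, integrableOn_Icc_iff_integrableOn_Ioc]; exact hq)
    rwa [uIcc_of_le hT.le] at this
  -- The gap `2 * ε < t - s` keeps the two nodes in order. The term `3 * ε` collects two exchanges
  -- of `v` for `u` and the source error.
  have hnode : ∀ ε > 0, ε < T → 2 * ε < t - s → ∃ a ∈ Icc 0 T, ∃ b ∈ Icc 0 T, |a - s| ≤ ε ∧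
      |b - t| ≤ ε ∧ ‖u b - p.1‖ - ‖u a - p.1‖ ≤ (∫ τ in (0 : ℝ)..b, q τ) -
        (∫ τ in (0 : ℝ)..a, q τ) + (T * (2 * ε / l) + 3 * ε) := by
    intro ε hε hεT hεst
    obtain ⟨N, r, g, v, H, huv⟩ := hu.approx ε hε
    obtain ⟨i, hi, his⟩ := H.exists_node hεT hsI.1 hsI.2
    obtain ⟨j, hj, hjt⟩ := H.exists_node hεT htI.1 htI.2
    have h1 := abs_le.1 his
    have h2 := abs_le.1 hjt
    have hij : i + 1 ≤ j + 1 := by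
      by_contra hcon
      have := H.mono (i := j + 1) (j := i + 1) (by omega) hi
      linarith
    refine ⟨r (i + 1), ⟨H.nonneg hi, H.le_T hi⟩, r (j + 1), ⟨H.nonneg hj, H.le_T hj⟩, his, hjt, ?_⟩
    have h3 : _ ≤ (∫ τ in (r (i + 1))..(r (j + 1)), q τ) + _ + _ :=
      H.norm_sub_norm_le_integral hA hh hu.continuousOn huv hp hl hij hj
    have h4 := huv i hi (r (i + 1)) ⟨H.lt_succ i hi, le_rfl⟩
    have h5 := huv j hj (r (j + 1)) ⟨H.lt_succ j hj, le_rfl⟩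
    have h6 := norm_sub_le_norm_sub_add_norm_sub (u (r (j + 1))) (v (j + 1)) p.1
    have h7 : ‖v (i + 1) - p.1‖ ≤ ‖v (i + 1) - u (r (i + 1))‖ + ‖u (r (i + 1)) - p.1‖ :=
      norm_sub_le_norm_sub_add_norm_sub _ _ _
    rw [norm_sub_rev (v (i + 1)) (u (r (i + 1)))] at h7
    have h8 : ∑ m ∈ Finset.Ico (i + 1) (j + 1), ∫ τ in (r m)..(r (m + 1)), ‖h τ - g m‖ ≤ ε := by
      refine (Finset.sum_le_sum_of_subset_of_nonneg ?_ ?_).trans H.source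
      · intro m hm
        rw [Finset.mem_Ico] at hm
        exact Finset.mem_range.2 (by omega)
      · intro m hm _
        exact intervalIntegral.integral_nonneg (H.lt_succ m (Finset.mem_range.1 hm)).le
          fun _ _ => norm_nonneg _
    have h9 : (r (j + 1) - r (i + 1)) * (2 * ε / l) ≤ T * (2 * ε / l) :=
      mul_le_mul_of_nonneg_right (by linarith [H.nonneg hi, H.le_T hj]) (by positivity)
    have h10 : (∫ τ in (0 : ℝ)..(r (i + 1)), q τ) + (∫ τ in (r (i + 1))..(r (j + 1)), q τ) =
        ∫ τ in (0 : ℝ)..(r (j + 1)), q τ := intervalIntegral.integral_add_adjacent_intervals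
      (intervalIntegrable_of_mem hq le_rfl (H.nonneg hi) (H.le_T hi))
      (intervalIntegrable_of_mem hq (H.nonneg hi) (H.mono hij hj) (H.le_T hj))
    linarith
  have hlim : Tendsto (fun n : ℕ => 1 / ((n : ℝ) + 1)) atTop (𝓝 0) :=
    tendsto_one_div_add_atTop_nhds_zero_nat
  have hev : ∀ n : ℕ, ∃ ab : ℝ × ℝ, 1 / ((n : ℝ) + 1) < T → 2 * (1 / ((n : ℝ) + 1)) < t - s →
      (ab.1 ∈ Icc 0 T ∧ ab.2 ∈ Icc 0 T ∧ |ab.1 - s| ≤ 1 / ((n : ℝ) + 1) ∧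
      |ab.2 - t| ≤ 1 / ((n : ℝ) + 1) ∧ ‖u ab.2 - p.1‖ - ‖u ab.1 - p.1‖ ≤
        (∫ τ in (0 : ℝ)..ab.2, q τ) - (∫ τ in (0 : ℝ)..ab.1, q τ) +
        (T * (2 * (1 / ((n : ℝ) + 1)) / l) + 3 * (1 / ((n : ℝ) + 1)))) := by
    intro n
    by_cases h1 : 1 / ((n : ℝ) + 1) < T ∧ 2 * (1 / ((n : ℝ) + 1)) < t - s
    · obtain ⟨a, ha, b, hb, h2⟩ := hnode _ (by positivity) h1.1 h1.2
      exact ⟨(a, b), fun _ _ => ⟨ha, hb, h2⟩⟩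
    · exact ⟨0, fun h2 h3 => absurd ⟨h2, h3⟩ h1⟩
  choose ab hab using hev
  have hab' : ∀ᶠ n : ℕ in atTop, ((ab n).1 ∈ Icc 0 T ∧ (ab n).2 ∈ Icc 0 T ∧
      |(ab n).1 - s| ≤ 1 / ((n : ℝ) + 1) ∧ |(ab n).2 - t| ≤ 1 / ((n : ℝ) + 1) ∧
      ‖u (ab n).2 - p.1‖ - ‖u (ab n).1 - p.1‖ ≤
        (∫ τ in (0 : ℝ)..(ab n).2, q τ) - (∫ τ in (0 : ℝ)..(ab n).1, q τ) +
        (T * (2 * (1 / ((n : ℝ) + 1)) / l) + 3 * (1 / ((n : ℝ) + 1)))) := by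
    have h2 : Tendsto (fun n : ℕ => 2 * (1 / ((n : ℝ) + 1))) atTop (𝓝 0) := by
      simpa using hlim.const_mul 2
    filter_upwards [hlim.eventually_lt_const hT, h2.eventually_lt_const (sub_pos.2 hst)]
      with n hn1 hn2 using hab n hn1 hn2
  have ha : Tendsto (fun n => (ab n).1) atTop (𝓝[Icc 0 T] s) := by
    refine tendsto_nhdsWithin_iff.2 ⟨?_, hab'.mono fun n hn => hn.1⟩
    rw [tendsto_iff_dist_tendsto_zero]
    exact squeeze_zero' (Eventually.of_forall fun _ => dist_nonneg)
      (hab'.mono fun n hn => hn.2.2.1) hlim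
  have hb : Tendsto (fun n => (ab n).2) atTop (𝓝[Icc 0 T] t) := by
    refine tendsto_nhdsWithin_iff.2 ⟨?_, hab'.mono fun n hn => hn.2.1⟩
    rw [tendsto_iff_dist_tendsto_zero]
    exact squeeze_zero' (Eventually.of_forall fun _ => dist_nonneg)
      (hab'.mono fun n hn => hn.2.2.2.1) hlim
  have hua := ((hu.continuousOn s hsI).tendsto.comp ha).sub_const p.1 |>.norm
  have hub := ((hu.continuousOn t htI).tendsto.comp hb).sub_const p.1 |>.norm
  have hFa := (hF s hsI).tendsto.comp ha
  have hFb := (hF t htI).tendsto.comp hb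
  have hrest : Tendsto (fun n : ℕ => T * (2 * (1 / ((n : ℝ) + 1)) / l) + 3 * (1 / ((n : ℝ) + 1)))
      atTop (𝓝 0) := by
    have := (((hlim.const_mul 2).div_const l).const_mul T).add (hlim.const_mul 3)
    simpa using this
  have hfin := le_of_tendsto_of_tendsto (hub.sub hua) ((hFb.sub hFa).add hrest)
    (hab'.mono fun n hn => hn.2.2.2.2)
  have h10 := intervalIntegral.integral_add_adjacent_intervals
    (intervalIntegrable_of_mem hq le_rfl hsI.1 hsI.2)
    (intervalIntegrable_of_mem hq hsI.1 hst.le htI.2)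
  linarith

/-- Mild solutions are integral solutions. -/
theorem IsMildSolution.isIntegralSolution {u : ℝ → X} (hu : IsMildSolution A T h u₀ u)
    (hA : IsAccretive A) (hT : 0 < T) (hh : IntegrableOn h (Ioc 0 T)) :
    IsIntegralSolution A T h u₀ u := by
  refine ⟨hu.continuousOn, hu.initial, fun p hp s t hs hst ht => ?_⟩
  rcases hst.eq_or_lt with rfl | hst'
  · simp
  refine ge_of_tendsto (x := 𝓝[>] (0 : ℝ))
    (f := fun l => ∫ τ in s..t, (‖u τ - p.1 + l • (h τ - p.2)‖ - ‖u τ - p.1‖) / l) ?_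
    (eventually_nhdsWithin_of_forall fun l hl =>
      hu.norm_sub_norm_le_integral hA hT hh hp hl hs hst' ht)
  refine intervalIntegral.tendsto_integral_filter_of_dominated_convergence
    (fun τ => ‖h τ - p.2‖) ?_ ?_ ?_ ?_
  · refine eventually_nhdsWithin_of_forall fun l hl => ?_
    rw [uIoc_of_le hst]
    exact ((integrableOn_norm_add_smul_div hu.continuousOn hh p hl).mono_set
      (Ioc_subset_Ioc hs ht)).1
  · exact eventually_nhdsWithin_of_forall fun l hl => Eventually.of_forall fun τ _ =>
      abs_norm_add_smul_sub_norm_div_le _ _ hl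
  · exact ((intervalIntegrable_of_mem hh hs hst ht).sub intervalIntegrable_const).norm
  · exact Eventually.of_forall fun τ _ => tendsto_normBracket _ _

end MildIntegral

/-! ### Scalar comparison and the semidiscrete barrier. -/

section Scalar

/-- If w(t) > 0, let σ be the supremum of the times up to t at which w ≤ w(t)/2. After σ the
integral of w is nonnegative. As w need not be continuous, σ may not be such a time; an earlier one
close to σ serves, the integral in between being small. Then w(t) grows by less than w(t)/2 from
there, a contradiction. -/
theorem nonpos_of_sub_le_neg_integral {T δ : ℝ} (hδ : 0 < δ) {w : ℝ → ℝ}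
    (hw : IntegrableOn w (Ioc 0 T))
    (hineq : ∀ s t, 0 < s → s ≤ t → t ≤ T → δ * (w t - w s) ≤ -∫ τ in s..t, w τ)
    (hinit : ∀ κ > 0, ∀ r > 0, ∃ s ∈ Ioo 0 r, w s ≤ κ) {t : ℝ} (ht : t ∈ Ioc 0 T) : w t ≤ 0 := by
  by_contra! hpos
  have hT : 0 < T := ht.1.trans_le ht.2
  set κ := w t / 2 with hκdef
  have hκ : 0 < κ := half_pos hpos
  set S := {s | s ∈ Ioc 0 t ∧ w s ≤ κ}
  obtain ⟨s₀, hs₀, hs₀κ⟩ := hinit κ hκ t ht.1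
  have hS₀ : s₀ ∈ S := ⟨⟨hs₀.1, hs₀.2.le⟩, hs₀κ⟩
  have hbdd : BddAbove S := ⟨t, fun s hs => hs.1.2⟩
  set σ := sSup S
  have hσt : σ ≤ t := csSup_le ⟨s₀, hS₀⟩ fun s hs => hs.1.2
  have hσ0 : 0 < σ := hs₀.1.trans_le (le_csSup hbdd hS₀)
  have hF : ContinuousOn (fun r => ∫ τ in (0 : ℝ)..r, w τ) (Icc 0 T) := by
    have := intervalIntegral.continuousOn_primitive_interval (a := 0) (b := T) (f := w)
      (μ := volume) (by rw [uIcc_of_le hT.le, integrableOn_Icc_iff_integrableOn_Ioc]; exact hw)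
    rwa [uIcc_of_le hT.le] at this
  obtain ⟨r, hr, hFr⟩ := Metric.continuousOn_iff.1 hF σ ⟨hσ0.le, hσt.trans ht.2⟩
    (δ * κ / 2) (by positivity)
  obtain ⟨s, hs, hsσ⟩ := exists_lt_of_lt_csSup ⟨s₀, hS₀⟩ (show σ - r < σ by linarith)
  have hsle : s ≤ σ := le_csSup hbdd hs
  have h1 := hFr s ⟨hs.1.1.le, hs.1.2.trans ht.2⟩ (by
    rw [Real.dist_eq, abs_sub_comm, abs_of_nonneg (by linarith)]; linarith)
  rw [Real.dist_eq, abs_sub_comm] at h1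
  have h2 := (abs_lt.1 h1).1
  have h3 := intervalIntegral.integral_add_adjacent_intervals
    (intervalIntegrable_of_mem hw le_rfl hs.1.1.le (hs.1.2.trans ht.2))
    (intervalIntegrable_of_mem hw hs.1.1.le hsle (hσt.trans ht.2))
  have h4 := intervalIntegral.integral_add_adjacent_intervals
    (intervalIntegrable_of_mem hw hs.1.1.le hsle (hσt.trans ht.2))
    (intervalIntegrable_of_mem hw hσ0.le hσt ht.2)
  have h5 : 0 ≤ ∫ τ in σ..t, w τ := by
    rw [intervalIntegral.integral_of_le hσt]
    refine setIntegral_nonneg measurableSet_Ioc fun τ hτ => ?_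
    by_contra! hneg
    have : τ ∈ S := ⟨⟨hσ0.trans hτ.1, hτ.2⟩, by linarith⟩
    exact absurd (le_csSup hbdd this) (not_le.2 hτ.1)
  have h6 := hineq s t hs.1.1 hs.1.2 ht.2
  have h7 : δ * (w t - w s) < δ * κ := by
    have : 0 < δ * κ := by positivity
    linarith
  have h8 := lt_of_mul_lt_mul_left h7 hδ.le
  linarith [hs.2]

/-- The analogue of `sqrt_two_step` with the second step sent to zero: δ multiplies the derivative
of the root in τ. Continuous time has no mesh, so only ε times the discrete time remains under the
root. The proof is PQ ≤ (P² + Q²)/2. -/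
theorem sqrt_sub_sqrt_le {a b δ ε τ : ℝ} (hδ : 0 ≤ δ) (hδε : δ ≤ ε) (hab : b - a = δ) (ha : 0 ≤ a)
    (hb : 0 < √((τ - b) ^ 2 + ε * b)) :
    √((τ - a) ^ 2 + ε * a) - √((τ - b) ^ 2 + ε * b) ≤ δ * ((τ - b) / √((τ - b) ^ 2 + ε * b)) := by
  have hε : 0 ≤ ε := hδ.trans hδε
  have hb0 : 0 ≤ b := by linarith
  have sP := Real.sq_sqrt (show 0 ≤ (τ - a) ^ 2 + ε * a by positivity)
  have sQ := Real.sq_sqrt (show 0 ≤ (τ - b) ^ 2 + ε * b by positivity)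
  set P := √((τ - a) ^ 2 + ε * a)
  set Q := √((τ - b) ^ 2 + ε * b)
  rw [← mul_div_assoc, le_div_iff₀ hb]
  have h1 : (τ - a) ^ 2 + ε * a = (τ - b) ^ 2 + ε * b + (2 * δ * (τ - b) + δ * (δ - ε)) := by
    rw [← hab]; ring
  have h2 : 0 ≤ δ * (ε - δ) := mul_nonneg hδ (by linarith)
  nlinarith [sq_nonneg (P - Q)]

theorem hasDerivAt_sqrt_sq_add {b c τ : ℝ} (hc : 0 < c) :
    HasDerivAt (fun τ => √((τ - b) ^ 2 + c)) ((τ - b) / √((τ - b) ^ 2 + c)) τ := by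
  have h1 : HasDerivAt (fun τ : ℝ => (τ - b) ^ 2 + c) (2 * (τ - b)) τ := by
    simpa using (((hasDerivAt_id τ).sub_const b).pow 2).add_const c
  have h2 := h1.sqrt (by positivity)
  rwa [mul_div_mul_left _ _ two_ne_zero] at h2

theorem continuous_div_sqrt_sq_add {b c : ℝ} (hc : 0 < c) :
    Continuous fun τ : ℝ => (τ - b) / √((τ - b) ^ 2 + c) := by
  refine Continuous.div (by fun_prop) (by fun_prop) fun τ => ?_
  have : 0 < √((τ - b) ^ 2 + c) := Real.sqrt_pos.2 (by positivity)
  exact this.ne'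

/-- Allows actual times to be extracted from the essential limit at zero. -/
theorem neBot_nhdsGT_inf_ae : (𝓝[>] (0 : ℝ) ⊓ ae (volume : Measure ℝ)).NeBot := by
  rw [inf_neBot_iff]
  intro U hU V hV
  obtain ⟨r, hr, hrU⟩ := mem_nhdsGT_iff_exists_Ioo_subset.1 hU
  by_contra hcon
  have h1 : Ioo 0 r ⊆ Vᶜ := fun x hx hxV => hcon ⟨x, hrU hx, hxV⟩
  have h2 : volume (Ioo 0 r) = 0 := measure_mono_null h1 (mem_ae_iff.1 hV)
  rw [Real.volume_Ioo, ENNReal.ofReal_eq_zero] at h2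
  have : 0 < r := hr
  linarith

theorem isProbabilityMeasure_restrict_Icc_zero_one :
    IsProbabilityMeasure (volume.restrict (Icc (0 : ℝ) 1)) := ⟨by simp⟩

end Scalar

/-- The mean distance of the process `ν` to a point at a given time. -/
noncomputable def processDist {X : Type*} [NormedAddCommGroup X] (ν : ℝ → ℝ → X) (x : X) (t : ℝ) :
    ℝ :=
  ∫ α in Icc (0 : ℝ) 1, ‖ν t α - x‖

/-! ### Mean distance of an integral-process solution to an Euler scheme. -/

section ProcessEstimates

variable {X : Type*} [NormedAddCommGroup X]

theorem processDist_nonneg (ν : ℝ → ℝ → X) (x : X) (t : ℝ) : 0 ≤ processDist ν x t :=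
  integral_nonneg fun _ => norm_nonneg _

theorem integrable_norm_sub_of_integrableOn {f : ℝ → X} (hf : IntegrableOn f (Icc (0 : ℝ) 1))
    (x : X) : Integrable (fun α => ‖f α - x‖) (volume.restrict (Icc (0 : ℝ) 1)) :=
  (Integrable.sub hf (integrable_const x)).norm

theorem processDist_le_add {ν : ℝ → ℝ → X} {t : ℝ} (hν : IntegrableOn (ν t) (Icc (0 : ℝ) 1))
    (x y : X) : processDist ν x t ≤ processDist ν y t + ‖y - x‖ := by
  have := isProbabilityMeasure_restrict_Icc_zero_one
  have h1 : processDist ν x t ≤ ∫ α in Icc (0 : ℝ) 1, (‖ν t α - y‖ + ‖y - x‖) :=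
    integral_mono (integrable_norm_sub_of_integrableOn hν x)
      ((integrable_norm_sub_of_integrableOn hν y).add (integrable_const _))
      fun α => norm_sub_le_norm_sub_add_norm_sub _ _ _
  rwa [integral_add (integrable_norm_sub_of_integrableOn hν y) (integrable_const _),
    integral_const, probReal_univ, one_smul] at h1

theorem IsProcessMeasurable.prod {T : ℝ} {ν : ℝ → ℝ → X} (hν : IsProcessMeasurable T ν) :
    AEStronglyMeasurable (fun z : ℝ × ℝ => ν z.1 z.2)
      ((volume.restrict (Ioc 0 T)).prod (volume.restrict (Icc (0 : ℝ) 1))) := by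
  rw [Measure.prod_restrict]
  exact hν

variable [NormedSpace ℝ X] {A : Set (X × X)} {T : ℝ} {h : ℝ → X} {u₀ : X} {ν : ℝ → ℝ → X}

theorem IsProcessMeasurable.integrable_normBracket (hν : IsProcessMeasurable T ν)
    (hh : IntegrableOn h (Ioc 0 T)) (p : X × X) {s t : ℝ} (hs : 0 ≤ s) (ht : t ≤ T) :
    Integrable (fun z : ℝ × ℝ => normBracket (ν z.1 z.2 - p.1) (h z.1 - p.2))
      ((volume.restrict (Ioc s t)).prod (volume.restrict (Icc (0 : ℝ) 1))) := by
  have hsub : (volume.restrict (Ioc s t)).prod (volume.restrict (Icc (0 : ℝ) 1)) ≤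
      (volume.restrict (Ioc 0 T)).prod (volume.restrict (Icc (0 : ℝ) 1)) := by
    rw [Measure.prod_restrict, Measure.prod_restrict]
    exact Measure.restrict_mono (prod_mono (Ioc_subset_Ioc hs ht) le_rfl) le_rfl
  have h1 : Integrable (fun z : ℝ × ℝ => h z.1 - p.2)
      ((volume.restrict (Ioc s t)).prod (volume.restrict (Icc (0 : ℝ) 1))) := by
    have h2 : Integrable (fun τ => h τ - p.2) (volume.restrict (Ioc s t)) :=
      (hh.mono_set (Ioc_subset_Ioc hs ht)).sub (integrable_const _)
    exact h2.comp_fst _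
  refine Integrable.mono' h1.norm (aestronglyMeasurable_normBracket
    ((hν.prod.mono_measure hsub).sub aestronglyMeasurable_const) h1.1)
    (Eventually.of_forall fun z => abs_normBracket_le _ _)

namespace IsIntegralProcessSolution

theorem processDist_sub_le (hν : IsIntegralProcessSolution A T h u₀ ν) {p : X × X} (hp : p ∈ A)
    {s t : ℝ} (hs : 0 < s) (hst : s ≤ t) (ht : t ≤ T) :
    processDist ν p.1 t - processDist ν p.1 s ≤
      ∫ α in Icc (0 : ℝ) 1, ∫ τ in s..t, normBracket (ν τ α - p.1) (h τ - p.2) := by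
  have h1 := hν.ineq p hp s t hs hst ht
  rwa [integral_sub (integrable_norm_sub_of_integrableOn (hν.integrable t ⟨by linarith, ht⟩) _)
    (integrable_norm_sub_of_integrableOn (hν.integrable s ⟨hs, by linarith⟩) _)] at h1

/-- Fubini moves the average over α inside the time integral, so a pointwise bound on the bracket
becomes an inequality between functions of time. -/
theorem processDist_sub_le_of_forall_le (hν : IsIntegralProcessSolution A T h u₀ ν)
    (hh : IntegrableOn h (Ioc 0 T)) {p : X × X} (hp : p ∈ A)
    {s t : ℝ} (hs : 0 < s) (hst : s ≤ t) (ht : t ≤ T) {G : ℝ × ℝ → ℝ}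
    (hG : Integrable G ((volume.restrict (Ioc s t)).prod (volume.restrict (Icc (0 : ℝ) 1))))
    (hle : ∀ z, normBracket (ν z.1 z.2 - p.1) (h z.1 - p.2) ≤ G z) :
    processDist ν p.1 t - processDist ν p.1 s ≤
      ∫ τ in s..t, ∫ α in Icc (0 : ℝ) 1, G (τ, α) := by
  refine (hν.processDist_sub_le hp hs hst ht).trans ?_
  have hI := hν.measurable.integrable_normBracket hh p hs.le ht
  simp only [intervalIntegral.integral_of_le hst]
  rw [← integral_prod_symm _ hI, ← integral_prod _ hG]
  exact integral_mono hI hG hle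

theorem processDist_sub_le_integral (hν : IsIntegralProcessSolution A T h u₀ ν)
    (hh : IntegrableOn h (Ioc 0 T)) {p : X × X} (hp : p ∈ A)
    {s t : ℝ} (hs : 0 < s) (hst : s ≤ t) (ht : t ≤ T) :
    processDist ν p.1 t - processDist ν p.1 s ≤ ∫ τ in s..t, ‖h τ - p.2‖ := by
  have := isProbabilityMeasure_restrict_Icc_zero_one
  have h2 : Integrable (fun τ => ‖h τ - p.2‖) (volume.restrict (Ioc s t)) :=
    ((hh.mono_set (Ioc_subset_Ioc hs.le ht)).sub (integrable_const _)).norm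
  have h1 := hν.processDist_sub_le_of_forall_le hh hp hs hst ht
    (G := fun z => ‖h z.1 - p.2‖) (h2.comp_fst _)
    fun z => (le_abs_self _).trans (abs_normBracket_le _ _)
  simpa using h1

theorem exists_processDist_le (hν : IsIntegralProcessSolution A T h u₀ ν) {κ : ℝ} (hκ : 0 < κ)
    {r : ℝ} (hr : 0 < r) : ∃ s ∈ Ioo 0 r, processDist ν u₀ s ≤ κ := by
  have := neBot_nhdsGT_inf_ae
  have h1 : ∀ᶠ s in 𝓝[>] (0 : ℝ) ⊓ ae volume, processDist ν u₀ s < κ :=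
    hν.initial.eventually_lt_const hκ
  have h2 : ∀ᶠ s in 𝓝[>] (0 : ℝ) ⊓ ae volume, s ∈ Ioo 0 r :=
    inf_le_left (α := Filter ℝ) (Ioo_mem_nhdsGT hr)
  obtain ⟨s, h3, h4⟩ := (h1.and h2).exists
  exact ⟨s, h4, h3.le⟩

/-- The initial time tends to zero along times given by the essential limit. The resulting bound
makes mean distances integrable in time. -/
theorem processDist_le (hν : IsIntegralProcessSolution A T h u₀ ν) (hh : IntegrableOn h (Ioc 0 T))
    {p : X × X} (hp : p ∈ A) {t : ℝ} (ht : t ∈ Ioc 0 T) :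
    processDist ν p.1 t ≤ ‖u₀ - p.1‖ + ∫ τ in (0 : ℝ)..t, ‖h τ - p.2‖ := by
  refine le_of_forall_pos_le_add fun κ hκ => ?_
  obtain ⟨s, hs, hsκ⟩ := hν.exists_processDist_le hκ ht.1
  have h1 := hν.processDist_sub_le_integral hh hp hs.1 hs.2.le ht.2
  have h2 := processDist_le_add (hν.integrable s ⟨hs.1, hs.2.le.trans ht.2⟩) p.1 u₀
  have h3 : ∫ τ in s..t, ‖h τ - p.2‖ ≤ ∫ τ in (0 : ℝ)..t, ‖h τ - p.2‖ :=
    intervalIntegral.integral_mono_interval hs.1.le hs.2.le le_rfl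
      (Eventually.of_forall fun _ => norm_nonneg _)
      ((intervalIntegrable_of_mem hh le_rfl ht.1.le ht.2).sub intervalIntegrable_const).norm
  linarith

theorem aestronglyMeasurable_norm_sub (hν : IsIntegralProcessSolution A T h u₀ ν) (x : X) :
    AEStronglyMeasurable (fun z : ℝ × ℝ => ‖ν z.1 z.2 - x‖)
      ((volume.restrict (Ioc 0 T)).prod (volume.restrict (Icc (0 : ℝ) 1))) :=
  (hν.measurable.prod.sub aestronglyMeasurable_const).norm

theorem integrableOn_processDist (hν : IsIntegralProcessSolution A T h u₀ ν)
    (hh : IntegrableOn h (Ioc 0 T)) (hA : A.Nonempty) (x : X) :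
    IntegrableOn (processDist ν x) (Ioc 0 T) := by
  obtain ⟨p, hp⟩ := hA
  refine Integrable.mono'
    (integrable_const (‖u₀ - p.1‖ + (∫ τ in (0 : ℝ)..T, ‖h τ - p.2‖) + ‖p.1 - x‖))
    (hν.aestronglyMeasurable_norm_sub x).integral_prod_right'
    ((ae_restrict_iff' measurableSet_Ioc).2 (Eventually.of_forall fun t ht => ?_))
  rw [Real.norm_of_nonneg (processDist_nonneg _ _ _)]
  have h1 := hν.processDist_le hh hp ht
  have h2 := processDist_le_add (hν.integrable t ht) x p.1
  have h3 : ∫ τ in (0 : ℝ)..t, ‖h τ - p.2‖ ≤ ∫ τ in (0 : ℝ)..T, ‖h τ - p.2‖ :=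
    intervalIntegral.integral_mono_interval le_rfl ht.1.le ht.2
      (Eventually.of_forall fun _ => norm_nonneg _)
      ((intervalIntegrable_of_mem hh le_rfl (ht.1.le.trans ht.2) le_rfl).sub
        intervalIntegrable_const).norm
  linarith

theorem integrable_norm_sub (hν : IsIntegralProcessSolution A T h u₀ ν)
    (hh : IntegrableOn h (Ioc 0 T)) (hA : A.Nonempty) (x : X) :
    Integrable (fun z : ℝ × ℝ => ‖ν z.1 z.2 - x‖)
      ((volume.restrict (Ioc 0 T)).prod (volume.restrict (Icc (0 : ℝ) 1))) := by
  refine (integrable_prod_iff (hν.aestronglyMeasurable_norm_sub x)).2 ⟨?_, ?_⟩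
  · exact (ae_restrict_iff' measurableSet_Ioc).2 (Eventually.of_forall fun t ht =>
      integrable_norm_sub_of_integrableOn (hν.integrable t ht) x)
  · simp only [norm_norm]
    exact hν.integrableOn_processDist hh hA x

/-- The Euler step for the mean distance of an integral-process solution to a scheme. -/
theorem mul_processDist_sub_le (hν : IsIntegralProcessSolution A T h u₀ ν)
    (hh : IntegrableOn h (Ioc 0 T)) {ε : ℝ} {N : ℕ} {t : ℕ → ℝ} {g v : ℕ → X}
    (H : IsApproxSolution A T h u₀ ε N t g v) {i : ℕ} (hi : i < N) {r s : ℝ} (hr : 0 < r)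
    (hrs : r ≤ s) (hs : s ≤ T) :
    (t (i + 1) - t i) * (processDist ν (v (i + 1)) s - processDist ν (v (i + 1)) r) ≤
      ∫ τ in r..s, ((t (i + 1) - t i) * ‖h τ - g i‖ +
        (processDist ν (v i) τ - processDist ν (v (i + 1)) τ)) := by
  have := isProbabilityMeasure_restrict_Icc_zero_one
  have hδ : 0 < t (i + 1) - t i := sub_pos.2 (H.lt_succ i hi)
  have hp := H.scheme i hi
  set δ := t (i + 1) - t i
  have hsub : (volume.restrict (Ioc r s)).prod (volume.restrict (Icc (0 : ℝ) 1)) ≤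
      (volume.restrict (Ioc 0 T)).prod (volume.restrict (Icc (0 : ℝ) 1)) := by
    rw [Measure.prod_restrict, Measure.prod_restrict]
    exact Measure.restrict_mono (prod_mono (Ioc_subset_Ioc hr.le hs) le_rfl) le_rfl
  have i1 : Integrable (fun τ => ‖h τ - g i‖) (volume.restrict (Ioc r s)) :=
    ((hh.mono_set (Ioc_subset_Ioc hr.le hs)).sub (integrable_const _)).norm
  have i2 := (hν.integrable_norm_sub hh ⟨_, hp⟩ (v i)).mono_measure hsub
  have i3 := (hν.integrable_norm_sub hh ⟨_, hp⟩ (v (i + 1))).mono_measure hsub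
  -- With the increment equal to the Euler step, `v (i + 1)` cancels and ν - `v i` + δ(h - `g i`)
  -- remains.
  have h1 := hν.processDist_sub_le_of_forall_le hh hp hr hrs hs
    (G := fun z => ‖h z.1 - g i‖ + (‖ν z.1 z.2 - v i‖ - ‖ν z.1 z.2 - v (i + 1)‖) / δ)
    ((i1.comp_fst _).add ((i2.sub i3).div_const δ)) (fun z => by
      refine (normBracket_le_div _ _ hδ).trans ?_
      simp only
      rw [div_le_iff₀ hδ, add_mul, div_mul_cancel₀ _ hδ.ne']
      have e : ν z.1 z.2 - v (i + 1) + δ • (h z.1 - (g i - δ⁻¹ • (v (i + 1) - v i))) =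
          (ν z.1 z.2 - v i) + δ • (h z.1 - g i) := by
        have e1 : δ • δ⁻¹ • (v (i + 1) - v i) = v (i + 1) - v i := by
          rw [smul_smul, mul_inv_cancel₀ hδ.ne', one_smul]
        rw [smul_sub, smul_sub, e1]
        module
      have h2 := norm_add_le (ν z.1 z.2 - v i) (δ • (h z.1 - g i))
      rw [norm_smul, Real.norm_of_nonneg hδ.le] at h2
      rw [e]
      linarith)
  refine (mul_le_mul_of_nonneg_left h1 hδ.le).trans (le_of_eq ?_)
  rw [← intervalIntegral.integral_const_mul, intervalIntegral.integral_of_le hrs,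
    intervalIntegral.integral_of_le hrs]
  refine setIntegral_congr_fun measurableSet_Ioc fun τ hτ => ?_
  simp only
  have hτ' := hν.integrable τ ⟨hr.trans hτ.1, hτ.2.trans hs⟩
  have j1 := integrable_norm_sub_of_integrableOn hτ' (v i)
  have j2 := integrable_norm_sub_of_integrableOn hτ' (v (i + 1))
  have j3 : Integrable (fun α => (‖ν τ α - v i‖ - ‖ν τ α - v (i + 1)‖) / δ)
      (volume.restrict (Icc (0 : ℝ) 1)) := (j1.sub j2).div_const δ
  rw [integral_add (integrable_const _) j3, integral_const, probReal_univ,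
    one_smul, integral_div, integral_sub j1 j2, mul_add, mul_div_cancel₀ _ hδ.ne']
  rfl

/-- Kobayashi's estimate for the mean distance of an integral-process solution to a scheme. -/
theorem processDist_le_of_isApproxSolution (hν : IsIntegralProcessSolution A T h u₀ ν)
    (hA : IsAccretive A) (hh : IntegrableOn h (Ioc 0 T)) {ε : ℝ} {N : ℕ} {t : ℕ → ℝ}
    {g v : ℕ → X} (H : IsApproxSolution A T h u₀ ε N t g v) {η B L : ℝ} {k : ℝ → X}
    (hk : IsSourceApprox T η B L h k) (hη : 0 ≤ η) {p : X × X} (hp : p ∈ A) {i : ℕ} (hi : i ≤ N)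
    {r : ℝ} (hr : r ∈ Ioc 0 T) :
    processDist ν (v i) r ≤ ‖v 0 - p.1‖ + ‖u₀ - p.1‖ + sourceDeviation k t g i +
      (∫ τ in (0 : ℝ)..r, ‖h τ - k τ‖) +
      (B + ‖p.2‖) * √((r - t i) ^ 2 + ε * t i) +
      t i * (η + L * (√((r - t i) ^ 2 + ε * t i) + ε)) := by
  have hε := H.eps_nonneg
  have hL := hk.nonneg
  have hM : 0 ≤ B + ‖p.2‖ := add_nonneg ((norm_nonneg _).trans (hk.norm_le 0)) (norm_nonneg _)
  have hT : 0 < T := hr.1.trans_le hr.2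
  have hkI : IntegrableOn (fun τ => ‖h τ - k τ‖) (Ioc 0 T) :=
    (hh.sub ((hk.continuous.integrableOn_Icc (a := 0) (b := T)).mono_set Ioc_subset_Icc_self)).norm
  induction i generalizing r with
  | zero =>
    have h1 := processDist_le_add (hν.integrable r hr) (v 0) p.1
    rw [norm_sub_rev] at h1
    have h2 := hν.processDist_le hh hp hr
    have i1 := intervalIntegrable_of_mem hkI le_rfl hr.1.le hr.2
    have h3 : ∫ τ in (0 : ℝ)..r, ‖h τ - p.2‖ ≤
        ∫ τ in (0 : ℝ)..r, (‖h τ - k τ‖ + (B + ‖p.2‖)) := by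
      refine intervalIntegral.integral_mono_on hr.1.le
        ((intervalIntegrable_of_mem hh le_rfl hr.1.le hr.2).sub intervalIntegrable_const).norm
        (i1.add intervalIntegrable_const) fun τ _ => ?_
      have h4 : ‖h τ - p.2‖ ≤ ‖h τ - k τ‖ + ‖k τ - p.2‖ := norm_sub_le_norm_sub_add_norm_sub _ _ _
      linarith [norm_sub_le (k τ) p.2, hk.norm_le τ]
    rw [intervalIntegral.integral_add i1 intervalIntegrable_const, intervalIntegral.integral_const,
      smul_eq_mul, sub_zero] at h3
    have h4 : √((r - t 0) ^ 2 + ε * t 0) = r := by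
      rw [H.start, mul_zero, add_zero, sub_zero, Real.sqrt_sq hr.1.le]
    have h5 : sourceDeviation k t g 0 = 0 := by simp [sourceDeviation]
    rw [h4, h5, H.start]
    linarith
  | succ i ih =>
    have hi' : i < N := hi
    have ih := fun {τ : ℝ} (hτ : τ ∈ Ioc 0 T) => ih hi'.le hτ
    have hδ : 0 < t (i + 1) - t i := sub_pos.2 (H.lt_succ i hi')
    have hδε := H.step_le i hi'
    have hε0 : 0 < ε := hδ.trans_le hδε
    have ha := H.nonneg hi'.le
    have hb : 0 < t (i + 1) := by linarith
    have hc : 0 < ε * t (i + 1) := mul_pos hε0 hb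
    have hdev : sourceDeviation k t g (i + 1) = sourceDeviation k t g i +
      (t (i + 1) - t i) * ‖g i - k (t (i + 1))‖ := Finset.sum_range_succ _ _
    have hinit := H.norm_sub_le_of_mem hA hk hp hi
    set a := t i with hadef
    set b := t (i + 1) with hbdef
    set M := B + ‖p.2‖
    set c := ‖v 0 - p.1‖ + ‖u₀ - p.1‖
    set F : ℝ → ℝ := fun τ => ∫ τ in (0 : ℝ)..τ, ‖h τ - k τ‖ with hF
    set Q : ℝ → ℝ := fun τ => √((τ - b) ^ 2 + ε * b) with hQ
    -- The claimed bound at node `i + 1` is a supersolution: the inductive bound on D_i gives δ‖h -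
    -- `g i`‖ + D_i - Φ ≤ δΦ' almost everywhere. Hence D_{i+1} - Φ satisfies the hypothesis of the
    -- scalar comparison.
    set Φ : ℝ → ℝ := fun τ => c + sourceDeviation k t g (i + 1) + F τ + M * Q τ +
      b * (η + L * (Q τ + ε)) with hΦ
    have hFc : ContinuousOn F (Icc 0 T) := by
      have := intervalIntegral.continuousOn_primitive_interval (a := 0) (b := T) (μ := volume)
        (f := fun τ => ‖h τ - k τ‖)
        (by rw [uIcc_of_le hT.le, integrableOn_Icc_iff_integrableOn_Ioc]; exact hkI)
      rwa [uIcc_of_le hT.le] at this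
    have hQc : Continuous Q := by simp only [hQ]; fun_prop
    have hΦI : IntegrableOn Φ (Ioc 0 T) := by
      have : ContinuousOn Φ (Icc 0 T) := by
        have := hQc.continuousOn (s := Icc 0 T)
        simp only [hΦ]
        fun_prop
      exact (this.integrableOn_Icc).mono_set Ioc_subset_Icc_self
    have hD := fun x => hν.integrableOn_processDist hh ⟨p, hp⟩ x
    suffices hw : processDist ν (v (i + 1)) r - Φ r ≤ 0 by
      have : processDist ν (v (i + 1)) r ≤ Φ r := by linarith
      exact this
    refine nonpos_of_sub_le_neg_integral hδ (w := fun τ => processDist ν (v (i + 1)) τ - Φ τ)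
      ((hD _).sub hΦI) ?_ ?_ hr
    · intro s r hs hsr hrT
      have h1 := hν.mul_processDist_sub_le hh H hi' hs hsr hrT
      rw [← hadef, ← hbdef] at h1
      have hpc := continuous_div_sqrt_sq_add (b := b) hc
      have h2 : ∫ τ in s..r, (τ - b) / √((τ - b) ^ 2 + ε * b) = Q r - Q s :=
        intervalIntegral.integral_eq_sub_of_hasDerivAt (fun τ _ => hasDerivAt_sqrt_sq_add hc)
          (hpc.intervalIntegrable _ _)
      have ik := intervalIntegrable_of_mem hkI hs.le hsr hrT
      have h3 := intervalIntegral.integral_add_adjacent_intervals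
        (intervalIntegrable_of_mem hkI le_rfl hs.le (hsr.trans hrT)) ik
      have ih0 : IntervalIntegrable (fun τ => (b - a) * ‖h τ - g i‖) volume s r :=
        ((intervalIntegrable_of_mem hh hs.le hsr hrT).sub intervalIntegrable_const).norm.const_mul _
      have iD := intervalIntegrable_of_mem (hD (v i)) hs.le hsr hrT
      have iD' := intervalIntegrable_of_mem (hD (v (i + 1))) hs.le hsr hrT
      have iΦ := intervalIntegrable_of_mem hΦI hs.le hsr hrT
      have i4 : IntervalIntegrable (fun τ => (M + L * b) * ((τ - b) / √((τ - b) ^ 2 + ε * b)))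
          volume s r := (hpc.intervalIntegrable _ _).const_mul _
      have key : (∫ τ in s..r, (((b - a) * ‖h τ - g i‖ +
          (processDist ν (v i) τ - processDist ν (v (i + 1)) τ)) +
          (processDist ν (v (i + 1)) τ - Φ τ))) ≤
          ∫ τ in s..r, (b - a) * (‖h τ - k τ‖ +
            (M + L * b) * ((τ - b) / √((τ - b) ^ 2 + ε * b))) := by
        refine intervalIntegral.integral_mono_on hsr ((ih0.add (iD.sub iD')).add (iD'.sub iΦ))
          ((ik.add i4).const_mul _) fun τ hτ => ?_
        have hτ' : τ ∈ Ioc 0 T := ⟨hs.trans_le hτ.1, hτ.2.trans hrT⟩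
        have h4 := ih hτ'
        have hQpos : 0 < √((τ - b) ^ 2 + ε * b) := Real.sqrt_pos.2 (by positivity)
        have h5 := sqrt_sub_sqrt_le hδ.le hδε rfl ha hQpos
        have h6 : ‖h τ - g i‖ ≤ ‖h τ - k τ‖ + ‖g i - k b‖ + (η + L * |τ - b|) := by
          have e : h τ - g i = (h τ - k τ) - (g i - k b) + (k τ - k b) := by abel
          rw [e]
          exact (norm_add_le _ _).trans (add_le_add (norm_sub_le _ _) (hk.modulus _ _))
        have h7 : |τ - b| ≤ √((τ - a) ^ 2 + ε * a) + ε := by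
          have h8 : |τ - a| ≤ √((τ - a) ^ 2 + ε * a) := abs_le_sqrt_add (mul_nonneg hε ha)
          have h9 := abs_sub_le τ a b
          rw [abs_sub_comm a b, abs_of_pos hδ] at h9
          linarith
        simp only [hΦ, hQ]
        rw [hdev]
        set P := √((τ - a) ^ 2 + ε * a)
        set R := √((τ - b) ^ 2 + ε * b)
        have m1 := mul_le_mul_of_nonneg_left h6 hδ.le
        have m2 := mul_le_mul_of_nonneg_left h7 (mul_nonneg hδ.le hL)
        have m3 := mul_le_mul_of_nonneg_left h5 (add_nonneg hM (mul_nonneg hL hb.le))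
        linarith
      rw [intervalIntegral.integral_add (ih0.add (iD.sub iD')) (iD'.sub iΦ),
        intervalIntegral.integral_const_mul, intervalIntegral.integral_add ik i4,
        intervalIntegral.integral_const_mul, h2] at key
      have h10 : Φ r - Φ s = (∫ τ in s..r, ‖h τ - k τ‖) + (M + L * b) * (Q r - Q s) := by
        simp only [hΦ, hF]
        linarith
      have h11 : (b - a) * (processDist ν (v (i + 1)) r - Φ r -
          (processDist ν (v (i + 1)) s - Φ s)) =
          (b - a) * (processDist ν (v (i + 1)) r - processDist ν (v (i + 1)) s) -
          (b - a) * (Φ r - Φ s) := by ring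
      rw [h11, h10]
      linarith
    · intro κ hκ R hR
      -- Since `Q s ≥ b - s`, the barrier falls short of the growth `M * b` of the scheme by at most
      -- `M * s`, which the last entry of the minimum makes at most `κ / 2`. The `+ 1` covers `M =
      -- 0`.
      obtain ⟨s, hs, hsκ⟩ := hν.exists_processDist_le (half_pos hκ)
        (r := min T (min R (κ / (2 * (M + 1))))) (by positivity)
      have hsT : s < T := hs.2.trans_le (min_le_left _ _)
      have hsR : s < R := hs.2.trans_le ((min_le_right _ _).trans (min_le_left _ _))
      have hsM : s < κ / (2 * (M + 1)) :=
        hs.2.trans_le ((min_le_right _ _).trans (min_le_right _ _))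
      refine ⟨s, ⟨hs.1, hsR⟩, ?_⟩
      have h1 := processDist_le_add (hν.integrable s ⟨hs.1, hsT.le⟩) (v (i + 1)) u₀
      have h2 : ‖u₀ - v (i + 1)‖ ≤ ‖u₀ - p.1‖ + ‖v (i + 1) - p.1‖ := by
        rw [norm_sub_rev (v (i + 1)) p.1]; exact norm_sub_le_norm_sub_add_norm_sub _ _ _
      have h3 : b - s ≤ Q s := by
        refine (le_abs_self _).trans ?_
        rw [abs_sub_comm]
        exact abs_le_sqrt_add hc.le
      have hQ0 : 0 ≤ Q s := Real.sqrt_nonneg _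
      have h4 : 0 ≤ F s := intervalIntegral.integral_nonneg hs.1.le fun _ _ => norm_nonneg _
      have h5 : 0 ≤ b * (η + L * (Q s + ε)) := by positivity
      have h6 := mul_le_mul_of_nonneg_left h3 hM
      have h7 : M * s ≤ κ / 2 := by
        rw [lt_div_iff₀ (by positivity)] at hsM
        linarith [hs.1]
      simp only [hΦ]
      linarith

end IsIntegralProcessSolution

/-- Integral-process solutions are close to approximate solutions with the same datum. -/
theorem exists_forall_processDist_le (hA : IsAccretive A) (hT : 0 < T)
    (hh : IntegrableOn h (Ioc 0 T)) (hu₀ : u₀ ∈ closure (operatorDomain A)) {κ : ℝ}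
    (hκ : 0 < κ) : ∃ ε > 0, ∀ (ν : ℝ → ℝ → X) (N : ℕ) (t : ℕ → ℝ) (g v : ℕ → X),
      IsIntegralProcessSolution A T h u₀ ν → IsApproxSolution A T h u₀ ε N t g v →
      ∀ i ≤ N, ∀ r ∈ Ioc 0 T, |t i - r| ≤ ε → processDist ν (v i) r ≤ κ := by
  set η := κ / (2 * (5 + 3 * T)) with hηdef
  have hη : 0 < η := by positivity
  have hηκ : (5 + 3 * T) * η < κ := by
    rw [hηdef]
    have : (5 + 3 * T) * (κ / (2 * (5 + 3 * T))) = κ / 2 := by field_simp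
    linarith
  obtain ⟨B, L, k, hk⟩ := exists_isSourceApprox hT hh hη
  obtain ⟨p, hp, hpη⟩ := exists_mem_norm_sub_le hu₀ hη
  obtain ⟨ε, hε, hεκ⟩ := exists_kobayashiBound_lt (B + ‖p.2‖) L hηκ
  refine ⟨ε, hε, fun ν N t g v hν H i hi r hr hir => ?_⟩
  refine le_trans ?_ hεκ.le
  have hL := hk.nonneg
  have hM : 0 ≤ B + ‖p.2‖ := add_nonneg ((norm_nonneg _).trans (hk.norm_le 0)) (norm_nonneg _)
  have h1 := hν.processDist_le_of_isApproxSolution hA hh H hk hη.le hp hi hr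
  have h2 := H.sourceDeviation_le hk hη.le hh hi
  have h3 : 0 ≤ ε + η + T * (η + L * ε) := by positivity
  have h4 : ‖v 0 - p.1‖ ≤ ε + η :=
    (norm_sub_le_norm_sub_add_norm_sub _ u₀ _).trans (add_le_add H.initial hpη)
  have h5 : ∫ τ in (0 : ℝ)..r, ‖h τ - k τ‖ ≤ η := by
    refine le_trans ?_ hk.error
    exact intervalIntegral.integral_mono_interval le_rfl hr.1.le hr.2
      (Eventually.of_forall fun _ => norm_nonneg _)
      ((intervalIntegrable_of_mem hh le_rfl hT.le le_rfl).sub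
        (hk.continuous.intervalIntegrable _ _)).norm
  have h6 : √((r - t i) ^ 2 + ε * t i) ≤ √(ε ^ 2 + ε * (2 * T)) := by
    refine Real.sqrt_le_sqrt (add_le_add ?_ ?_)
    · rw [← sq_abs, abs_sub_comm]
      exact pow_le_pow_left₀ (abs_nonneg _) hir 2
    · exact mul_le_mul_of_nonneg_left (by linarith [H.le_T hi]) hε.le
  have h7 := mul_le_mul_of_nonneg_left h6 hM
  have h8 : t i * (η + L * (√((r - t i) ^ 2 + ε * t i) + ε)) ≤
      T * (η + L * (√(ε ^ 2 + ε * (2 * T)) + ε)) := by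
    have := H.le_T hi
    gcongr
  unfold kobayashiBound
  linarith

end ProcessEstimates

/-! ### Identification of processes and integral solutions with the mild solution. -/

section Characterization

variable {X : Type*} [NormedAddCommGroup X] [NormedSpace ℝ X] {A : Set (X × X)} {T : ℝ}
  {h : ℝ → X} {u₀ : X} {u : ℝ → X} {ν : ℝ → ℝ → X}

/-- An integral-process solution coincides with every mild solution. -/
theorem IsIntegralProcessSolution.ae_eq (hν : IsIntegralProcessSolution A T h u₀ ν)
    (hA : IsAccretive A) (hT : 0 < T) (hh : IntegrableOn h (Ioc 0 T))
    (hu₀ : u₀ ∈ closure (operatorDomain A)) (hu : IsMildSolution A T h u₀ u) {r : ℝ}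
    (hr : r ∈ Ioc 0 T) : ∀ᵐ α ∂(volume.restrict (Icc (0 : ℝ) 1)), ν r α = u r := by
  have hrI : r ∈ Icc 0 T := Ioc_subset_Icc_self hr
  -- The three thirds of κ below are the distances from ν to a scheme value, from that value to `u`
  -- at its node, and from there to `u r`.
  have hle : processDist ν (u r) r ≤ 0 := by
    refine le_of_forall_pos_le_add fun κ hκ => ?_
    obtain ⟨ε, hε, hK⟩ := exists_forall_processDist_le (A := A) hA hT hh hu₀
      (show 0 < κ / 3 by positivity)
    obtain ⟨d, hd, hud⟩ := Metric.continuousOn_iff.1 hu.continuousOn r hrI (κ / 3) (by positivity)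
    obtain ⟨ε', hε', hle⟩ : ∃ ε' > 0, ε' ≤ ε ∧ ε' ≤ κ / 3 ∧ ε' < d ∧ ε' < T := by
      refine ⟨min (min ε (κ / 3)) (min (d / 2) (T / 2)), by positivity,
        (min_le_left _ _).trans (min_le_left _ _), (min_le_left _ _).trans (min_le_right _ _),
        ?_, ?_⟩
      · exact ((min_le_right _ _).trans (min_le_left _ _)).trans_lt (half_lt_self hd)
      · exact ((min_le_right _ _).trans (min_le_right _ _)).trans_lt (half_lt_self hT)
    obtain ⟨N, t, g, v, H, huv⟩ := hu.approx ε' hε'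
    obtain ⟨i, hi, hir⟩ := H.exists_node hle.2.2.2 hrI.1 hrI.2
    have h1 := hK ν N t g v hν (H.mono_eps hle.1) (i + 1) hi r hr (hir.trans hle.1)
    have h2 := huv i hi (t (i + 1)) ⟨H.lt_succ i hi, le_rfl⟩
    have h3 := hud (t (i + 1)) ⟨H.nonneg hi, H.le_T hi⟩ (hir.trans_lt hle.2.2.1)
    rw [dist_eq_norm] at h3
    have h4 := processDist_le_add (hν.integrable r hr) (u r) (v (i + 1))
    have h5 := norm_sub_le_norm_sub_add_norm_sub (v (i + 1)) (u (t (i + 1))) (u r)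
    rw [norm_sub_rev (v (i + 1)) (u (t (i + 1)))] at h5
    linarith [hle.2.1]
  have h0 : processDist ν (u r) r = 0 := le_antisymm hle (processDist_nonneg _ _ _)
  have h1 := (integral_eq_zero_iff_of_nonneg (fun α => norm_nonneg (ν r α - u r))
    (integrable_norm_sub_of_integrableOn (hν.integrable r hr) (u r))).1 h0
  filter_upwards [h1] with α hα
  exact sub_eq_zero.1 (norm_eq_zero.1 hα)

/-- Tonelli for ‖ν - u‖ₑ: joint measurability exchanges the order of the exceptional sets. -/
theorem ae_ae_eq_of_forall_ae_eq {X : Type*} [NormedAddCommGroup X] {T : ℝ} {ν : ℝ → ℝ → X}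
    {u : ℝ → X} (hν : IsProcessMeasurable T ν) (hu : ContinuousOn u (Icc 0 T))
    (hνu : ∀ t ∈ Ioc (0 : ℝ) T, ∀ᵐ α ∂(volume.restrict (Icc (0 : ℝ) 1)), ν t α = u t) :
    ∀ᵐ α ∂(volume.restrict (Icc (0 : ℝ) 1)), ∀ᵐ t ∂(volume.restrict (Ioc (0 : ℝ) T)),
      ν t α = u t := by
  have hs : AEStronglyMeasurable (fun z : ℝ × ℝ => ν z.1 z.2 - u z.1)
      ((volume.restrict (Ioc 0 T)).prod (volume.restrict (Icc (0 : ℝ) 1))) :=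
    hν.prod.sub hu.aestronglyMeasurable_Ioc.comp_fst
  have hm : AEMeasurable (Function.uncurry fun t α => ‖ν t α - u t‖ₑ)
      ((volume.restrict (Ioc 0 T)).prod (volume.restrict (Icc (0 : ℝ) 1))) := hs.enorm
  have h1 : ∫⁻ t in Ioc 0 T, ∫⁻ α in Icc (0 : ℝ) 1, ‖ν t α - u t‖ₑ = 0 := by
    rw [setLIntegral_congr_fun (g := fun _ => 0) measurableSet_Ioc]
    · simp
    · intro t ht
      rw [← lintegral_zero]
      refine lintegral_congr_ae ?_
      filter_upwards [hνu t ht] with α hα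
      simp [hα]
  rw [lintegral_lintegral_swap hm] at h1
  filter_upwards [(lintegral_eq_zero_iff' hm.lintegral_prod_left').1 h1, hs.prod_swap.prodMk_left]
    with α hα hmα
  filter_upwards [(lintegral_eq_zero_iff' hmα.enorm).1 hα] with t ht
  exact sub_eq_zero.1 (enorm_eq_zero.1 ht)

/-- The inner time integral runs along a fixed α, so equality at each single time does not suffice;
`ae_ae_eq_of_forall_ae_eq` supplies it along almost every curve. -/
theorem IsIntegralSolution.isIntegralProcessSolution (hu : IsIntegralSolution A T h u₀ u)
    (hT : 0 < T) (hν : IsProcessMeasurable T ν)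
    (hνu : ∀ t ∈ Ioc (0 : ℝ) T, ∀ᵐ α ∂(volume.restrict (Icc (0 : ℝ) 1)), ν t α = u t) :
    IsIntegralProcessSolution A T h u₀ ν := by
  have := isProbabilityMeasure_restrict_Icc_zero_one
  refine ⟨hν, fun t ht => ?_, fun p hp s t hs hst ht => ?_, ?_⟩
  · exact (integrable_const (u t)).congr ((hνu t ht).mono fun α hα => hα.symm)
  · have h1 : ∫ α in Icc (0 : ℝ) 1, (‖ν t α - p.1‖ - ‖ν s α - p.1‖) =
        ‖u t - p.1‖ - ‖u s - p.1‖ := by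
      rw [integral_congr_ae (g := fun _ => ‖u t - p.1‖ - ‖u s - p.1‖), integral_const,
        probReal_univ, one_smul]
      filter_upwards [hνu t ⟨hs.trans_le hst, ht⟩, hνu s ⟨hs, hst.trans ht⟩] with α h1 h2
      rw [h1, h2]
    have h2 : ∫ α in Icc (0 : ℝ) 1, ∫ τ in s..t, normBracket (ν τ α - p.1) (h τ - p.2) =
        ∫ τ in s..t, normBracket (u τ - p.1) (h τ - p.2) := by
      rw [integral_congr_ae (g := fun _ => ∫ τ in s..t, normBracket (u τ - p.1) (h τ - p.2)),
        integral_const, probReal_univ, one_smul]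
      filter_upwards [ae_ae_eq_of_forall_ae_eq hν hu.continuousOn hνu] with α hα
      rw [intervalIntegral.integral_of_le hst, intervalIntegral.integral_of_le hst]
      refine integral_congr_ae ?_
      filter_upwards [ae_restrict_of_ae_restrict_of_subset (Ioc_subset_Ioc hs.le ht) hα] with τ hτ
      rw [hτ]
    rw [h1, h2]
    exact hu.ineq p hp s t hs.le hst ht
  · have h1 : Tendsto (fun t => ‖u t - u₀‖) (𝓝[>] (0 : ℝ)) (𝓝 0) := by
      have h2 : Tendsto u (𝓝[>] (0 : ℝ)) (𝓝 (u 0)) :=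
        (hu.continuousOn 0 ⟨le_rfl, hT.le⟩).tendsto.mono_left
          (nhdsWithin_le_of_mem (Icc_mem_nhdsGT hT))
      rw [hu.initial] at h2
      simpa using (h2.sub_const u₀).norm
    refine (Tendsto.congr' ?_ h1).mono_left inf_le_left
    filter_upwards [Ioc_mem_nhdsGT hT] with t ht
    rw [integral_congr_ae (g := fun _ => ‖u t - u₀‖), integral_const, probReal_univ, one_smul]
    filter_upwards [hνu t ht] with α hα
    rw [hα]

/-- Integral solutions and mild solutions coincide. -/
theorem IsIntegralSolution.eqOn (hA : IsAccretive A) (hT : 0 < T) (hh : IntegrableOn h (Ioc 0 T))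
    (hu₀ : u₀ ∈ closure (operatorDomain A)) (hu : IsMildSolution A T h u₀ u) {w : ℝ → X}
    (hw : IsIntegralSolution A T h u₀ w) : EqOn w u (Icc 0 T) := by
  have := isProbabilityMeasure_restrict_Icc_zero_one
  intro t ht
  rcases ht.1.eq_or_lt with rfl | ht0
  · rw [hw.initial, hu.initial]
  have hm : IsProcessMeasurable T fun t _ => w t := by
    have h1 := (hw.continuousOn.aestronglyMeasurable_Ioc).comp_fst
      (ν := volume.restrict (Icc (0 : ℝ) 1))
    rw [Measure.prod_restrict] at h1
    exact h1
  -- Viewed as a process constant in α, `w` falls under the comparison with mild solutions.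
  have hν : IsIntegralProcessSolution A T h u₀ fun t _ => w t :=
    hw.isIntegralProcessSolution hT hm fun t _ => Eventually.of_forall fun _ => rfl
  exact (hν.ae_eq hA hT hh hu₀ hu ⟨ht0, ht.2⟩).exists.choose_spec

end Characterization

theorem theorem3 {X : Type*} [NormedAddCommGroup X] [NormedSpace ℝ X] [CompleteSpace X]
    (A : Set (X × X)) (hA : IsMAccretive A) (T : ℝ) (hT : 0 < T)
    (h : ℝ → X) (hh : IntegrableOn h (Ioc 0 T))
    (u₀ : X) (hu₀ : u₀ ∈ closure (operatorDomain A)) :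
    ∃ u : ℝ → X,
      -- `u` is, on `[0, T]`, the unique integral solution and the unique mild solution
      IsIntegralSolution A T h u₀ u ∧
      IsMildSolution A T h u₀ u ∧
      (∀ w : ℝ → X, IsIntegralSolution A T h u₀ w → EqOn w u (Icc 0 T)) ∧
      (∀ w : ℝ → X, IsMildSolution A T h u₀ w → EqOn w u (Icc 0 T)) ∧
      -- characterization of the integral-process solutions
      (∀ ν : ℝ → ℝ → X, IsProcessMeasurable T ν →
        (IsIntegralProcessSolution A T h u₀ ν ↔
          IsIndependentOfParameter T ν ∧
          ∀ t ∈ Ioc (0 : ℝ) T, ∀ᵐ α ∂(volume.restrict (Icc (0 : ℝ) 1)), ν t α = u t)) ∧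
      -- in particular, for almost every `α`, the curve `ν(·, α)` is `u`
      (∀ ν : ℝ → ℝ → X, IsIntegralProcessSolution A T h u₀ ν →
        ∀ᵐ α ∂(volume.restrict (Icc (0 : ℝ) 1)),
          ∀ᵐ t ∂(volume.restrict (Ioc (0 : ℝ) T)), ν t α = u t) := by
  obtain ⟨u, hu⟩ := hA.exists_isMildSolution hT hh hu₀
  have hui := hu.isIntegralSolution hA.1 hT hh
  refine ⟨u, hui, hu, fun w hw => hw.eqOn hA.1 hT hh hu₀ hu,
    fun w hw => (hw.isIntegralSolution hA.1 hT hh).eqOn hA.1 hT hh hu₀ hu, fun ν hm => ⟨fun hν => ?_,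
    fun hν => hui.isIntegralProcessSolution hT hm hν.2⟩, fun ν hν => ?_⟩
  · have h1 := fun t ht => hν.ae_eq hA.1 hT hh hu₀ hu (r := t) ht
    exact ⟨fun t ht => ⟨u t, h1 t ht⟩, h1⟩
  · exact ae_ae_eq_of_forall_ae_eq hν.measurable hu.continuousOn
      fun t ht => hν.ae_eq hA.1 hT hh hu₀ hu ht
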